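/- Let $P,Q\in\mathbb{Z}[x]$ be polynomials that are squarefree in $\mathbb{Q}[x]$ (no repeated non-constant factor; non-zero constants are allowed) and have resultant $\operatorname{res}(P,Q)\neq 0$. Then there is a constant $C$ depending only on $P$ and $Q$ such that the following holds for all multiplicative functions $f,g:\mathbb{N}\to\{z\in\mathbb{C}:|z|\le 1\}$, extended to $\mathbb{Z}$ by $f(-n)=f(n)$, $f(0)=0$, and likewise for $g$ (throughout, $p$ denotes a prime and $n$ a positive integer). For each prime $p$ let $f_p$ be the multiplicative function with $f_p(p^k)=f(p^k)$ and $f_p(q^k)=1$ for all primes $q\ne p$ and $k\ge 1$; define $g_p$ in the same way, and extend both to $\mathbb{Z}$ as above. Then the limit $$M_p(f(P),g(Q))=\lim_{x\to\infty}\frac1x\sum_{n\le x}f_p(P(n))\,g_p(Q(n))$$ exists for every prime $p$, and for every real $x>e$ $$\left|\frac1x\sum_{n\le x}f(P(n))\,g(Q(n))-\prod_{p\le x}M_p(f(P),g(Q))\right|\le C\left(\mathbb{D}_P(1,f;\log x;x)+\mathbb{D}_Q(1,g;\log x;x)+\frac{1}{\log\log x}\right).$$ Here $N_P(x)$ is the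 set of prime powers $p^k$ with $p\ge x$, $k\ge1$, such that $p^k\mid P(n)$ and $p^{k+1}\nmid P(n)$ for some $n\le x$, and $$\mathbb{D}_P(f,g;y;x)=\left(\sum_{y\le p\le x}\frac{1-\operatorname{Re}(f(p)\overline{g(p)})}{p}+\sum_{p^k\in N_P(x)}\frac{1-\operatorname{Re}(f(p^k)\overline{g(p^k)})}{x}\right)^{1/2},$$ with $N_Q(x)$ and $\mathbb{D}_Q$ defined in the same way from $Q$. -/

import Mathlib

open Filter Topology Polynomial

/-- For an arithmetic function `f` and a number `p` (meant to be prime), the arithmetic function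
`f_p` with `f_p(n) = f(p^k)` for `n ≥ 1`, where `p^k` is the exact power of `p` dividing `n`.
If `f` is multiplicative, this is the multiplicative function with `f_p(p^k) = f(p^k)` and
`f_p(q^k) = 1` for primes `q ≠ p`. -/
noncomputable def localPart (f : ArithmeticFunction ℂ) (p : ℕ) : ArithmeticFunction ℂ where
  toFun n := if n = 0 then 0 else f (p ^ n.factorization p)
  map_zero' := if_pos rfl

/-- The mean `(1/x) ∑_{1 ≤ n ≤ x} f(|P(n)|) g(|Q(n)|)`. Arithmetic functions take the value `0`
at `0`. -/
noncomputable def corrMean (f g : ArithmeticFunction ℂ) (P Q : ℤ[X]) (x : ℝ) : ℂ :=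
  (∑ n ∈ Finset.Icc 1 ⌊x⌋₊, f (P.eval (n : ℤ)).natAbs * g (Q.eval (n : ℤ)).natAbs) / (x : ℂ)

/-- The local correlation
`M_p(f(P), g(Q)) = lim_{x → ∞} (1/x) ∑_{n ≤ x} f_p(P(n)) g_p(Q(n))`. -/
noncomputable def localCorr (f g : ArithmeticFunction ℂ) (P Q : ℤ[X]) (p : ℕ) : ℂ :=
  limUnder atTop (corrMean (localPart f p) (localPart g p) P Q)

/-- The finite set `N_P(x)` of the prime powers `p^k` with `p ≥ x`, `k ≥ 1`, such that `p^k`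
divides `P(n)` exactly for some positive integer `n ≤ x`; see `mem_largePrimePowers`. -/
noncomputable def largePrimePowers (P : ℤ[X]) (x : ℝ) : Finset ℕ :=
  (Finset.Icc 1 ⌊x⌋₊).biUnion fun n =>
    ((P.eval (n : ℤ)).natAbs.primeFactors.filter fun p : ℕ => x ≤ (p : ℝ)).image
      fun p : ℕ => p ^ (P.eval (n : ℤ)).natAbs.factorization p

theorem mem_largePrimePowers (P : ℤ[X]) (x : ℝ) (q : ℕ) :
    q ∈ largePrimePowers P x ↔
      ∃ p k : ℕ, p.Prime ∧ x ≤ (p : ℝ) ∧ 1 ≤ k ∧ q = p ^ k ∧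
        ∃ n : ℕ, 1 ≤ n ∧ (n : ℝ) ≤ x ∧
          (p : ℤ) ^ k ∣ P.eval (n : ℤ) ∧ ¬ (p : ℤ) ^ (k + 1) ∣ P.eval (n : ℤ) := by
  have key : ∀ (p k : ℕ) (z : ℤ), (p : ℤ) ^ k ∣ z ↔ p ^ k ∣ z.natAbs := by
    intro p k z
    rw [← Int.natCast_dvd]
    push_cast
    rfl
  simp only [largePrimePowers, Finset.mem_biUnion, Finset.mem_Icc, Finset.mem_image,
    Finset.mem_filter, key]
  constructor
  · rintro ⟨n, ⟨hn1, hn2⟩, p, ⟨hp, hxp⟩, rfl⟩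
    have hpp := Nat.prime_of_mem_primeFactors hp
    have h0 : (P.eval (n : ℤ)).natAbs ≠ 0 := (Nat.mem_primeFactors.1 hp).2.2
    refine ⟨p, _, hpp, hxp, ?_, rfl, n, hn1,
      (Nat.le_floor_iff' (by omega)).1 hn2, Nat.ordProj_dvd _ _,
      Nat.pow_succ_factorization_not_dvd h0 hpp⟩
    exact (hpp.dvd_iff_one_le_factorization h0).1 (Nat.dvd_of_mem_primeFactors hp)
  · rintro ⟨p, k, hp, hxp, hk, rfl, n, hn1, hn2, hd, hnd⟩
    have h0 : (P.eval (n : ℤ)).natAbs ≠ 0 := by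
      intro h
      exact hnd (h ▸ dvd_zero _)
    refine ⟨n, ⟨hn1, (Nat.le_floor_iff' (by omega)).2 hn2⟩, p, ⟨?_, hxp⟩, ?_⟩
    · exact Nat.mem_primeFactors.2 ⟨hp, (dvd_pow_self p (by omega)).trans hd, h0⟩
    · rw [hp.pow_dvd_iff_le_factorization h0] at hd hnd
      congr 1
      omega

/-- The distance
`𝔻_P(f, g; y; x) = (∑_{y ≤ p ≤ x} (1 - Re (f(p) conj(g(p)))) / p
  + ∑_{p^k ∈ N_P(x)} (1 - Re (f(p^k) conj(g(p^k)))) / x)^{1/2}`. -/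
noncomputable def polyDist (P : ℤ[X]) (f g : ℕ → ℂ) (y x : ℝ) : ℝ :=
  √((∑ p ∈ (Finset.Icc 1 ⌊x⌋₊).filter fun p : ℕ => p.Prime ∧ y ≤ (p : ℝ),
        (1 - (f p * starRingEnd ℂ (g p)).re) / (p : ℝ)) +
    ∑ q ∈ largePrimePowers P x, (1 - (f q * starRingEnd ℂ (g q)).re) / x)

/-!
The mean of `f(P(n)) g(Q(n))` is compared with the product of its local means by splitting the
product of local factors `F_p(n) = f_p(P(n)) g_p(Q(n))` according to the size of `p`.

* A squarefree polynomial has boundedly many roots modulo prime powers (`exists_rootBound`), since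
  some nonzero integer is a combination of `P` and `P'`. Hence `F_p` agrees with the `p ^ k`-periodic
  function `truncFactor` for all `n` but a proportion `O(p ^ (-k - 1))`; this gives the existence of
  the local means and lets both sides be replaced by their truncations.
* For `p ≤ Y`, with `Y` of size `log x / 20`, the common period of the truncated factors is at most
  `√x` by Chebyshev's bound, and by the Chinese remainder theorem the mean of their product is the
  product of their means (`norm_sum_prod_small_sub_le`).
* The primes between `Y` and `log x` cost `O(1 / log log x)`, because there are
  `O(log x / log log x)` of them.
* For `log x ≤ p ≤ x ^ (1 / 8)` the product is concentrated around the product of its means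
  (`sum_norm_prod_truncFactor_sub_prod_periodMean_le`): for numbers `z` in the unit disc, `∏ z` is
  close to `exp (∑ (z - 1))`, and the exponent has variance `O(𝔻 ^ 2)` by a Turán–Kubilius
  inequality, whose off-diagonal terms vanish up to `O(x ^ (1 / 2))` by periodicity.
* For `x ^ (1 / 8) ≤ p ≤ x` the sum of `1 / p` is bounded, so by Cauchy–Schwarz these primes cost
  `O(𝔻)` (`sum_norm_sub_one_div_le_polyDist`).
* For `p > x` the values `P(n)` have boundedly many such prime factors, and each prime power occurs
  boundedly often; Cauchy–Schwarz bounds the cost by the second part of `𝔻`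
  (`sum_large_primeFactors_le`).

A prime may divide both `P(n)` and `Q(n)`: the factor `F_p(n)` differs from `1` by at most the sum of
the contributions of `f` and `g`, which is all that is used.
-/

/-! ### Roots of a squarefree polynomial modulo prime powers -/

/-- The number of `n ≤ N` with `p ^ k ∣ P(n)` is at most `K (N / p ^ k + 1)`, uniformly in the
prime power `p ^ k` and in `N`. -/
def RootBound (P : ℤ[X]) (K : ℝ) : Prop :=
  ∀ p k N : ℕ, p.Prime →
    (((Finset.Icc 1 N).filter fun n : ℕ => p ^ k ∣ (P.eval (n : ℤ)).natAbs).card : ℝ) ≤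
      K * ((N : ℝ) / (p : ℝ) ^ k + 1)

theorem RootBound.mono {P : ℤ[X]} {K L : ℝ} (h : RootBound P K) (hKL : K ≤ L) :
    RootBound P L := fun p k N hp => by
  refine (h p k N hp).trans ?_
  gcongr

/-- Constant polynomials need a separate argument: their resultant with the derivative `0` is `1`. -/
theorem exists_mul_add_derivative_mul_eq_C (P : ℤ[X])
    (hP : Squarefree (P.map (Int.castRingHom ℚ))) :
    ∃ D : ℤ, D ≠ 0 ∧ ∃ A B : ℤ[X], P * A + derivative P * B = C D := by
  have hP0 : P ≠ 0 := by
    rintro rfl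
    simp at hP
  by_cases hd : P.natDegree = 0
  · obtain ⟨c, rfl⟩ := natDegree_eq_zero.1 hd
    exact ⟨c, by simpa using hP0, 1, 0, by simp⟩
  · refine ⟨P.resultant (derivative P), ?_, ?_⟩
    · have hsep : (P.map (Int.castRingHom ℚ)).Separable := PerfectField.separable_iff_squarefree.2 hP
      have hinj : Function.Injective (Int.castRingHom ℚ) := Int.cast_injective
      have h := resultant_ne_zero _ _ hsep
      rw [derivative_map, resultant_map_map, natDegree_map_eq_of_injective hinj,
        natDegree_map_eq_of_injective hinj] at h
      intro h0
      rw [h0] at h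
      simp at h
    · obtain ⟨A, B, -, -, h⟩ := exists_mul_add_mul_eq_C_resultant P (derivative P) le_rfl le_rfl
        (Or.inl hd)
      exact ⟨A, B, h⟩

theorem pow_dvd_of_pow_dvd_mul_of_not_pow_succ_dvd {p k d : ℕ} (hp : p.Prime) {a u : ℤ}
    (h : (p : ℤ) ^ (k + d) ∣ a * u) (hu : ¬ (p : ℤ) ^ (d + 1) ∣ u) : (p : ℤ) ^ k ∣ a := by
  have hp' : Prime (p : ℤ) := Nat.prime_iff_prime_int.1 hp
  have hu0 : u ≠ 0 := by
    rintro rfl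
    exact hu (dvd_zero _)
  obtain ⟨c, hc, hc'⟩ := (FiniteMultiplicity.of_prime_left hp' hu0).exists_eq_pow_mul_and_not_dvd
  set j := multiplicity (p : ℤ) u with hj
  have hjd : j ≤ d := by
    by_contra hcon
    rw [hc] at hu
    exact hu (dvd_mul_of_dvd_left (pow_dvd_pow _ (by omega)) _)
  have h1 : (p : ℤ) ^ (k + d) ∣ (a * (p : ℤ) ^ j) * c := by
    rw [mul_assoc, ← hc]; exact h
  have h2 : (p : ℤ) ^ (k + d) ∣ a * (p : ℤ) ^ j := hp'.pow_dvd_of_dvd_mul_right _ hc' h1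
  have h3 : (p : ℤ) ^ k * (p : ℤ) ^ j ∣ a * (p : ℤ) ^ j := by
    rw [← pow_add]
    exact (pow_dvd_pow _ (by omega)).trans h2
  exact (mul_dvd_mul_iff_right (pow_ne_zero _ hp'.ne_zero)).1 h3

/-- Two roots of `P` modulo `p ^ (k + d)` that agree modulo `p ^ (d + 1)` agree modulo `p ^ k`,
where `p ^ d` is the power of `p` in a constant of the ideal `(P, P')`: at a root, `P'` is not
divisible by `p ^ (d + 1)`. -/
theorem roots_congr_of_congr {P A B : ℤ[X]} {D : ℤ} (hD : P * A + derivative P * B = C D)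
    {p k d : ℕ} (hp : p.Prime) (hk : 1 ≤ k) (hd : ¬ (p : ℤ) ^ (d + 1) ∣ D) {m n : ℤ}
    (hn : (p : ℤ) ^ (k + d) ∣ P.eval n) (hm : (p : ℤ) ^ (k + d) ∣ P.eval m)
    (hmn : (p : ℤ) ^ (d + 1) ∣ m - n) : (p : ℤ) ^ k ∣ m - n := by
  obtain ⟨c, hc⟩ := P.binomExpansion n (m - n)
  have hder : ¬ (p : ℤ) ^ (d + 1) ∣ (derivative P).eval n := by
    intro h
    apply hd
    have h1 := congrArg (eval n) hD
    simp only [eval_add, eval_mul, eval_C] at h1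
    rw [← h1]
    exact dvd_add (dvd_mul_of_dvd_left ((pow_dvd_pow _ (by omega)).trans hn) _)
      (dvd_mul_of_dvd_left h _)
  refine pow_dvd_of_pow_dvd_mul_of_not_pow_succ_dvd hp (d := d)
    (u := (derivative P).eval n + (m - n) * c) ?_ ?_
  · have h2 : (m - n) * ((derivative P).eval n + (m - n) * c) = P.eval m - P.eval n := by
      rw [add_sub_cancel] at hc
      rw [hc]; ring
    rw [h2]
    exact dvd_sub hm hn
  · intro h
    exact hder ((dvd_add_left (dvd_mul_of_dvd_left hmn _)).1 h)

/-- A set of pairwise congruent numbers modulo `a` in an interval of length `a * b` has at most `b`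
elements. -/
theorem card_le_of_pairwise_congr {a b c : ℕ} (S : Finset ℕ)
    (hS : S ⊆ Finset.Ico c (c + a * b)) (h : ∀ m ∈ S, ∀ n ∈ S, (a : ℤ) ∣ (m : ℤ) - n) :
    S.card ≤ b := by
  have hmap : ∀ n ∈ S, (n - c) / a ∈ Finset.range b := by
    intro n hn
    have := Finset.mem_Ico.1 (hS hn)
    rw [Finset.mem_range]
    apply Nat.div_lt_of_lt_mul
    omega
  have hinj : Set.InjOn (fun n => (n - c) / a) S := by
    intro m hm n hn hmn
    have h1 := Finset.mem_Ico.1 (hS hm)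
    have h2 := Finset.mem_Ico.1 (hS hn)
    have h3 := h m hm n hn
    have h4 : (m - c) % a = (n - c) % a := by
      have : (m - c) ≡ (n - c) [MOD a] := by
        rw [Nat.modEq_iff_dvd, Nat.cast_sub h1.1, Nat.cast_sub h2.1]
        have := h n hn m hm
        convert this using 1; ring
      exact this
    have h5 := Nat.div_add_mod (m - c) a
    have h6 := Nat.div_add_mod (n - c) a
    simp only at hmn
    rw [hmn, h4, h6] at h5
    omega
  simpa using Finset.card_le_card_of_injOn _ hmap hinj

theorem card_Icc_filter_le_of_window {q K : ℕ} (hq : 0 < q) (S : ℕ → Prop) [DecidablePred S]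
    (h : ∀ c, ((Finset.Ico c (c + q)).filter S).card ≤ K) (N : ℕ) :
    ((Finset.Icc 1 N).filter S).card ≤ K * (N / q + 1) := by
  have := Finset.card_le_mul_card_image_of_maps_to (s := (Finset.Icc 1 N).filter S)
    (t := Finset.range (N / q + 1)) (f := fun n => n / q) ?_ K ?_
  · simpa using this
  · intro n hn
    rw [Finset.mem_filter, Finset.mem_Icc] at hn
    rw [Finset.mem_range]
    exact Nat.lt_succ_of_le (Nat.div_le_div_right hn.1.2)
  · intro j _
    refine (Finset.card_le_card ?_).trans (h (j * q))
    intro n hn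
    simp only [Finset.mem_filter, Finset.mem_Icc] at hn
    simp only [Finset.mem_filter, Finset.mem_Ico]
    refine ⟨?_, hn.1.2⟩
    have h1 := Nat.div_add_mod n q
    have h2 := Nat.mod_lt n hq
    rw [hn.2, mul_comm] at h1
    omega

/-- A squarefree integer polynomial has boundedly many roots modulo prime powers. -/
theorem exists_card_roots_le (P : ℤ[X]) (hP : Squarefree (P.map (Int.castRingHom ℚ))) :
    ∃ K : ℕ, ∀ p k c : ℕ, p.Prime →
      ((Finset.Ico c (c + p ^ k)).filter fun n : ℕ => p ^ k ∣ (P.eval (n : ℤ)).natAbs).card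
        ≤ K := by
  obtain ⟨D, hD0, A, B, hD⟩ := exists_mul_add_derivative_mul_eq_C P hP
  refine ⟨D.natAbs * (P.natDegree + D.natAbs ^ 2) + D.natAbs, fun p k c hp => ?_⟩
  have hDpos : 0 < D.natAbs := Int.natAbs_pos.2 hD0
  have hdvd : ∀ (e : ℕ) (z : ℤ), (p : ℤ) ^ e ∣ z ↔ p ^ e ∣ z.natAbs := by
    intro e z
    rw [← Int.natCast_dvd]; push_cast; rfl
  set d := D.natAbs.factorization p with hd
  have hd1 : p ^ d ∣ D.natAbs := Nat.ordProj_dvd _ _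
  have hd2 : ¬ (p : ℤ) ^ (d + 1) ∣ D := by
    rw [hdvd]
    exact Nat.pow_succ_factorization_not_dvd hDpos.ne' hp
  have hdle : p ^ d ≤ D.natAbs := Nat.le_of_dvd hDpos hd1
  set S := (Finset.Ico c (c + p ^ k)).filter fun n : ℕ => p ^ k ∣ (P.eval (n : ℤ)).natAbs with hS
  rcases le_or_gt k d with hkd | hkd
  · calc S.card ≤ (Finset.Ico c (c + p ^ k)).card := Finset.card_filter_le _ _
      _ = p ^ k := by simp
      _ ≤ p ^ d := Nat.pow_le_pow_right hp.pos hkd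
      _ ≤ _ := hdle.trans (Nat.le_add_left _ _)
  · obtain ⟨e, rfl⟩ := Nat.exists_eq_add_of_lt hkd
    have hroot : ∀ n ∈ S, (p : ℤ) ^ (e + 1 + d) ∣ P.eval (n : ℤ) := by
      intro n hn
      rw [hdvd]
      have := (Finset.mem_filter.1 hn).2
      rwa [show d + e + 1 = e + 1 + d by ring] at this
    -- Each residue class modulo `p ^ (d + 1)` contributes at most `p ^ d` roots.
    have hfib : S.card ≤ p ^ d * (S.image fun n : ℕ => (n : ZMod (p ^ (d + 1)))).card := by
      refine Finset.card_le_mul_card_image _ _ fun a _ => ?_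
      refine card_le_of_pairwise_congr (a := p ^ (e + 1)) (c := c) _ ?_ ?_
      · intro n hn
        have := (Finset.mem_filter.1 (Finset.mem_filter.1 hn).1).1
        rwa [← pow_add, show e + 1 + d = d + e + 1 by ring]
      · intro m hm n hn
        have hm' := Finset.mem_filter.1 hm
        have hn' := Finset.mem_filter.1 hn
        have := roots_congr_of_congr hD hp (k := e + 1) (by omega) hd2
          (hroot n hn'.1) (hroot m hm'.1) ?_
        · simpa using this
        · have h1 : ((m : ℤ) : ZMod (p ^ (d + 1))) = ((n : ℤ) : ZMod (p ^ (d + 1))) := by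
            simpa using hm'.2.trans hn'.2.symm
          have := (ZMod.intCast_eq_intCast_iff_dvd_sub _ _ _).1 h1.symm
          simpa using this
    have himg : (S.image fun n : ℕ => (n : ZMod (p ^ (d + 1)))).card ≤
        P.natDegree + D.natAbs ^ 2 := by
      rcases Nat.eq_zero_or_pos d with h0 | h0
      · have : Fact p.Prime := ⟨hp⟩
        have hne : P.map (Int.castRingHom (ZMod p)) ≠ 0 := by
          intro h
          apply hd2
          rw [h0, zero_add, pow_one, ← ZMod.intCast_zmod_eq_zero_iff_dvd]
          have h1 := congrArg (Polynomial.map (Int.castRingHom (ZMod p))) hD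
          simp only [Polynomial.map_add, Polynomial.map_mul, h, ← derivative_map,
            Polynomial.map_C, derivative_zero, zero_mul, zero_add] at h1
          exact (C_eq_zero.1 h1.symm)
        refine le_trans ?_ (Nat.le_add_right _ _)
        have hsub : (S.image fun n : ℕ => (n : ZMod p)) ⊆
            (P.map (Int.castRingHom (ZMod p))).roots.toFinset := by
          intro a ha
          obtain ⟨n, hn, rfl⟩ := Finset.mem_image.1 ha
          rw [Multiset.mem_toFinset, mem_roots hne, IsRoot.def]
          have h1 : (p : ℤ) ∣ P.eval (n : ℤ) :=
            (dvd_pow_self _ (by omega)).trans (hroot n hn)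
          rw [← ZMod.intCast_zmod_eq_zero_iff_dvd] at h1
          rw [← h1, show ((n : ℕ) : ZMod p) = Int.castRingHom (ZMod p) (n : ℤ) by simp, eval_map_apply]
          rfl
        have hcast : (S.image fun n : ℕ => (n : ZMod (p ^ (d + 1)))).card =
            (S.image fun n : ℕ => (n : ZMod p)).card := by
          rw [h0, zero_add, pow_one]
        rw [hcast]
        calc _ ≤ _ := Finset.card_le_card hsub
          _ ≤ _ := Multiset.toFinset_card_le _
          _ ≤ _ := card_roots' _
          _ ≤ _ := natDegree_map_le
      · have : NeZero (p ^ (d + 1)) := ⟨(pow_pos hp.pos _).ne'⟩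
        calc _ ≤ Fintype.card (ZMod (p ^ (d + 1))) := Finset.card_le_univ _
          _ = p ^ (d + 1) := ZMod.card _
          _ ≤ p ^ (d * 2) := Nat.pow_le_pow_right hp.pos (by omega)
          _ = (p ^ d) ^ 2 := pow_mul _ _ _
          _ ≤ D.natAbs ^ 2 := Nat.pow_le_pow_left hdle 2
          _ ≤ _ := Nat.le_add_left _ _
    calc S.card ≤ _ := hfib
      _ ≤ D.natAbs * (P.natDegree + D.natAbs ^ 2) := Nat.mul_le_mul hdle himg
      _ ≤ _ := Nat.le_add_right _ _

theorem exists_rootBound (P : ℤ[X]) (hP : Squarefree (P.map (Int.castRingHom ℚ))) :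
    ∃ K : ℝ, 1 ≤ K ∧ RootBound P K := by
  obtain ⟨K, hK⟩ := exists_card_roots_le P hP
  refine ⟨K + 1, by simp, fun p k N hp => ?_⟩
  have h := card_Icc_filter_le_of_window (pow_pos hp.pos k) _ (fun c => hK p k c hp) N
  have h1 : ((N / p ^ k : ℕ) : ℝ) ≤ (N : ℝ) / (p : ℝ) ^ k := by
    simpa using Nat.cast_div_le (α := ℝ) (m := N) (n := p ^ k)
  have h2 : (0 : ℝ) ≤ (N : ℝ) / (p : ℝ) ^ k := by positivity
  calc _ ≤ ((K * (N / p ^ k + 1) : ℕ) : ℝ) := Nat.cast_le.2 h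
    _ = K * (((N / p ^ k : ℕ) : ℝ) + 1) := by push_cast; ring
    _ ≤ (K + 1) * ((N : ℝ) / (p : ℝ) ^ k + 1) := by gcongr; simp

/-! ### Means of periodic functions -/

/-- The mean of `b` over `0, 1, …, q - 1`; for `b` of period `q`, its mean value. -/
noncomputable def periodMean (b : ℕ → ℂ) (q : ℕ) : ℂ :=
  (∑ n ∈ Finset.range q, b n) / q

theorem sum_range_add_of_periodic {b : ℕ → ℂ} {q : ℕ} (hb : Function.Periodic b q) (c : ℕ) :
    ∑ n ∈ Finset.range q, b (c + n) = ∑ n ∈ Finset.range q, b n := by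
  induction c with
  | zero => simp
  | succ c ih =>
    rw [← ih]
    have h1 := Finset.sum_range_succ (fun n => b (c + n)) q
    have h2 := Finset.sum_range_succ' (fun n => b (c + n)) q
    rw [h1] at h2
    have h3 : b (c + q) = b (c + 0) := hb c
    rw [h3] at h2
    have h4 := add_right_cancel h2
    rw [h4]
    refine Finset.sum_congr rfl fun n _ => ?_
    congr 1; omega

theorem norm_sum_range_le_of_periodic {c : ℕ → ℂ} {q : ℕ} {B : ℝ} (hq : 0 < q)
    (hc : Function.Periodic c q) (h0 : ∑ n ∈ Finset.range q, c n = 0) (hB : ∀ n, ‖c n‖ ≤ B)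
    (N : ℕ) : ‖∑ n ∈ Finset.range N, c n‖ ≤ B * q := by
  have hB0 : 0 ≤ B := (norm_nonneg _).trans (hB 0)
  induction N using Nat.strong_induction_on with
  | _ N ih =>
    rcases lt_or_ge N q with h | h
    · calc _ ≤ ∑ n ∈ Finset.range N, ‖c n‖ := norm_sum_le _ _
        _ ≤ ∑ n ∈ Finset.range N, B := Finset.sum_le_sum fun n _ => hB n
        _ = N * B := by simp
        _ ≤ q * B := by gcongr
        _ = B * q := mul_comm _ _
    · obtain ⟨M, rfl⟩ := Nat.exists_eq_add_of_le' h
      rw [Finset.sum_range_add, sum_range_add_of_periodic hc, h0, add_zero]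
      exact ih M (by omega)

theorem norm_periodMean_le {b : ℕ → ℂ} {B : ℝ} (hB0 : 0 ≤ B) (hB : ∀ n, ‖b n‖ ≤ B) (q : ℕ) :
    ‖periodMean b q‖ ≤ B := by
  rw [periodMean, norm_div, Complex.norm_natCast]
  refine div_le_of_le_mul₀ (Nat.cast_nonneg _) hB0 ?_
  calc _ ≤ ∑ n ∈ Finset.range q, ‖b n‖ := norm_sum_le _ _
    _ ≤ ∑ n ∈ Finset.range q, B := Finset.sum_le_sum fun n _ => hB n
    _ = B * q := by simp [mul_comm]

theorem sum_Icc_one_eq_sum_range (b : ℕ → ℂ) (N : ℕ) :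
    ∑ n ∈ Finset.Icc 1 N, b n = ∑ n ∈ Finset.range N, b (1 + n) := by
  rw [Finset.range_eq_Ico, Finset.sum_Ico_add b 0 N 1]
  rfl

/-- Over full periods the deviation from the mean cancels, so only one incomplete period counts. -/
theorem norm_sum_Icc_sub_periodMean_le {b : ℕ → ℂ} {q : ℕ} {B : ℝ} (hq : 0 < q)
    (hb : Function.Periodic b q) (hB : ∀ n, ‖b n‖ ≤ B) (N : ℕ) :
    ‖∑ n ∈ Finset.Icc 1 N, b n - N * periodMean b q‖ ≤ 2 * B * q := by
  have hB0 : 0 ≤ B := (norm_nonneg _).trans (hB 0)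
  have hq' : (q : ℂ) ≠ 0 := by exact_mod_cast hq.ne'
  have := norm_sum_range_le_of_periodic (c := fun n => b (1 + n) - periodMean b q) (B := 2 * B) hq
    (fun n => by simp only [← add_assoc]; rw [hb]) ?_ (fun n => ?_) N
  · rw [sum_Icc_one_eq_sum_range]
    simpa using this
  · rw [Finset.sum_sub_distrib, sum_range_add_of_periodic hb]
    simp [periodMean, mul_div_cancel₀ _ hq']
  · calc _ ≤ ‖b (1 + n)‖ + ‖periodMean b q‖ := norm_sub_le _ _
      _ ≤ B + B := add_le_add (hB _) (norm_periodMean_le hB0 hB q)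
      _ = 2 * B := by ring

/-- Chinese remainder theorem: functions with coprime periods are uncorrelated. -/
theorem periodMean_mul {b₁ b₂ : ℕ → ℂ} {q₁ q₂ : ℕ} (h1 : 0 < q₁) (h2 : 0 < q₂)
    (hb₁ : Function.Periodic b₁ q₁) (hb₂ : Function.Periodic b₂ q₂) (hq : q₁.Coprime q₂) :
    periodMean (fun n => b₁ n * b₂ n) (q₁ * q₂) = periodMean b₁ q₁ * periodMean b₂ q₂ := by
  have key : ∑ n ∈ Finset.range (q₁ * q₂), b₁ n * b₂ n =
      ∑ x ∈ Finset.range q₁ ×ˢ Finset.range q₂, b₁ x.1 * b₂ x.2 := by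
    refine Finset.sum_nbij' (fun n => (n % q₁, n % q₂))
      (fun x => (Nat.chineseRemainder hq x.1 x.2 : ℕ)) ?_ ?_ ?_ ?_ ?_
    · intro n _
      simp [Nat.mod_lt _ h1, Nat.mod_lt _ h2]
    · intro x _
      exact Finset.mem_range.2 (Nat.chineseRemainder_lt_mul hq _ _ h1.ne' h2.ne')
    · intro n hn
      have h := (Nat.chineseRemainder hq (n % q₁) (n % q₂)).2
      have h' : (Nat.chineseRemainder hq (n % q₁) (n % q₂) : ℕ) ≡ n [MOD q₁ * q₂] :=
        (Nat.modEq_and_modEq_iff_modEq_mul hq).1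
          ⟨h.1.trans (Nat.mod_modEq _ _), h.2.trans (Nat.mod_modEq _ _)⟩
      exact h'.eq_of_lt_of_lt (Nat.chineseRemainder_lt_mul hq _ _ h1.ne' h2.ne')
        (Finset.mem_range.1 hn)
    · rintro ⟨a, b⟩ hx
      simp only [Finset.mem_product, Finset.mem_range] at hx
      have h := (Nat.chineseRemainder hq a b).2
      ext
      · exact Eq.trans h.1 (Nat.mod_eq_of_lt hx.1)
      · exact Eq.trans h.2 (Nat.mod_eq_of_lt hx.2)
    · intro n _
      simp only [hb₁.map_mod_nat, hb₂.map_mod_nat]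
  rw [periodMean, periodMean, periodMean, key, Finset.sum_product, div_mul_div_comm,
    Finset.sum_mul_sum]
  push_cast
  rfl

theorem periodMean_prod {ι : Type*} (s : Finset ι) (q : ι → ℕ) (b : ι → ℕ → ℂ)
    (hq : ∀ i ∈ s, 0 < q i) (hb : ∀ i ∈ s, Function.Periodic (b i) (q i))
    (hc : (s : Set ι).Pairwise fun i j => (q i).Coprime (q j)) :
    Function.Periodic (fun n => ∏ i ∈ s, b i n) (∏ i ∈ s, q i) ∧
      periodMean (fun n => ∏ i ∈ s, b i n) (∏ i ∈ s, q i) = ∏ i ∈ s, periodMean (b i) (q i) := by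
  classical
  induction s using Finset.induction_on with
  | empty => exact ⟨fun _ => by simp, by simp [periodMean]⟩
  | insert a s ha ih =>
    have ih' := ih (fun i hi => hq i (Finset.mem_insert_of_mem hi))
      (fun i hi => hb i (Finset.mem_insert_of_mem hi))
      (hc.mono (by simp))
    have hba := hb a (Finset.mem_insert_self _ _)
    simp only [Finset.prod_insert ha]
    refine ⟨?_, ?_⟩
    · intro n
      have h1 : b a (n + q a * ∏ i ∈ s, q i) = b a n := by
        rw [mul_comm]; exact hba.nat_mul _ _
      have h2 := ih'.1.nat_mul (q a) n
      simp only [Nat.cast_id] at h2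
      exact congrArg₂ (· * ·) h1 h2
    · rw [periodMean_mul (hq a (Finset.mem_insert_self _ _))
        (Finset.prod_pos fun i hi => hq i (Finset.mem_insert_of_mem hi)) hba ih'.1 ?_, ih'.2]
      refine Nat.Coprime.prod_right fun i hi => hc (by simp) (by simp [hi]) ?_
      rintro rfl
      exact ha hi

/-! ### Local factors and their truncations -/

/-- The factor of `f(P(n)) g(Q(n))` at the prime `p`. -/
noncomputable def localFactor (f g : ArithmeticFunction ℂ) (P Q : ℤ[X]) (p n : ℕ) : ℂ :=
  localPart f p (P.eval (n : ℤ)).natAbs * localPart g p (Q.eval (n : ℤ)).natAbs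

/-- The factor of `f(P(n)) g(Q(n))` at the prime `p`, with powers of `p` beyond `p ^ k` ignored.
It is periodic in `n` with period `p ^ k`. -/
noncomputable def truncFactor (f g : ArithmeticFunction ℂ) (P Q : ℤ[X]) (p k n : ℕ) : ℂ :=
  f ((P.eval (n : ℤ)).natAbs.gcd (p ^ k)) * g ((Q.eval (n : ℤ)).natAbs.gcd (p ^ k))

theorem localPart_apply {f : ArithmeticFunction ℂ} {p m : ℕ} (hm : m ≠ 0) :
    localPart f p m = f (p ^ m.factorization p) := if_neg hm

theorem norm_localPart_le {f : ArithmeticFunction ℂ} (hf : ∀ n, ‖f n‖ ≤ 1) (p m : ℕ) :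
    ‖localPart f p m‖ ≤ 1 := by
  rcases eq_or_ne m 0 with rfl | hm
  · simp
  · rw [localPart_apply hm]; exact hf _

theorem norm_localFactor_le {f g : ArithmeticFunction ℂ} (hf : ∀ n, ‖f n‖ ≤ 1)
    (hg : ∀ n, ‖g n‖ ≤ 1) (P Q : ℤ[X]) (p n : ℕ) : ‖localFactor f g P Q p n‖ ≤ 1 := by
  rw [localFactor, norm_mul]
  exact mul_le_one₀ (norm_localPart_le hf _ _) (norm_nonneg _) (norm_localPart_le hg _ _)

theorem norm_truncFactor_le {f g : ArithmeticFunction ℂ} (hf : ∀ n, ‖f n‖ ≤ 1)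
    (hg : ∀ n, ‖g n‖ ≤ 1) (P Q : ℤ[X]) (p k n : ℕ) : ‖truncFactor f g P Q p k n‖ ≤ 1 := by
  rw [truncFactor, norm_mul]
  exact mul_le_one₀ (hf _) (norm_nonneg _) (hg _)

theorem gcd_natAbs_eval_periodic (P : ℤ[X]) (q : ℕ) :
    Function.Periodic (fun n : ℕ => (P.eval (n : ℤ)).natAbs.gcd q) q := by
  intro n
  have h : (q : ℤ) ∣ P.eval ((n + q : ℕ) : ℤ) - P.eval (n : ℤ) := by
    refine Dvd.dvd.trans ?_ (sub_dvd_eval_sub _ _ P)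
    simp
  obtain ⟨c, hc⟩ := h
  have h1 : P.eval ((n + q : ℕ) : ℤ) = P.eval (n : ℤ) + q * c := by rw [← hc]; ring
  change Int.gcd (P.eval ((n + q : ℕ) : ℤ)) (q : ℤ) = Int.gcd (P.eval (n : ℤ)) (q : ℤ)
  rw [h1, Int.gcd_add_mul_left_left]

theorem truncFactor_periodic (f g : ArithmeticFunction ℂ) (P Q : ℤ[X]) (p k : ℕ) :
    Function.Periodic (truncFactor f g P Q p k) (p ^ k) := by
  intro n
  have h1 := gcd_natAbs_eval_periodic P (p ^ k) n
  have h2 := gcd_natAbs_eval_periodic Q (p ^ k) n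
  simp only at h1 h2
  rw [truncFactor, truncFactor, h1, h2]

theorem gcd_pow_eq_pow_factorization {m p k : ℕ} (hp : p.Prime) (h : ¬ p ^ (k + 1) ∣ m) :
    m.gcd (p ^ k) = p ^ m.factorization p := by
  have hm : m ≠ 0 := by
    rintro rfl
    exact h (dvd_zero _)
  have hv : m.factorization p ≤ k := by
    by_contra hcon
    exact h ((hp.pow_dvd_iff_le_factorization hm).2 (by omega))
  refine Nat.dvd_antisymm ?_ (Nat.dvd_gcd (Nat.ordProj_dvd _ _) (pow_dvd_pow _ hv))
  obtain ⟨j, -, hj⟩ := (Nat.dvd_prime_pow hp).1 (Nat.gcd_dvd_right m (p ^ k))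
  rw [hj]
  refine pow_dvd_pow _ ((hp.pow_dvd_iff_le_factorization hm).1 ?_)
  rw [← hj]
  exact Nat.gcd_dvd_left _ _

theorem localFactor_eq_truncFactor {f g : ArithmeticFunction ℂ} {P Q : ℤ[X]} {p k n : ℕ}
    (hp : p.Prime) (hP : ¬ p ^ (k + 1) ∣ (P.eval (n : ℤ)).natAbs)
    (hQ : ¬ p ^ (k + 1) ∣ (Q.eval (n : ℤ)).natAbs) :
    localFactor f g P Q p n = truncFactor f g P Q p k n := by
  have hne : ∀ m : ℕ, ¬ p ^ (k + 1) ∣ m → m ≠ 0 := by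
    rintro m h rfl
    exact h (dvd_zero _)
  rw [localFactor, truncFactor, localPart_apply (hne _ hP), localPart_apply (hne _ hQ),
    gcd_pow_eq_pow_factorization hp hP, gcd_pow_eq_pow_factorization hp hQ]

theorem norm_localFactor_sub_truncFactor_le {f g : ArithmeticFunction ℂ} (hf : ∀ n, ‖f n‖ ≤ 1)
    (hg : ∀ n, ‖g n‖ ≤ 1) (P Q : ℤ[X]) {p k : ℕ} (hp : p.Prime) (n : ℕ) :
    ‖localFactor f g P Q p n - truncFactor f g P Q p k n‖ ≤
      2 * (if p ^ (k + 1) ∣ (P.eval (n : ℤ)).natAbs then (1 : ℝ) else 0) +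
        2 * (if p ^ (k + 1) ∣ (Q.eval (n : ℤ)).natAbs then (1 : ℝ) else 0) := by
  have h2 : ‖localFactor f g P Q p n - truncFactor f g P Q p k n‖ ≤ 2 := by
    refine (norm_sub_le _ _).trans ?_
    linarith [norm_localFactor_le hf hg P Q p n, norm_truncFactor_le hf hg P Q p k n]
  by_cases hP : p ^ (k + 1) ∣ (P.eval (n : ℤ)).natAbs
  · rw [if_pos hP]
    split_ifs <;> linarith
  · by_cases hQ : p ^ (k + 1) ∣ (Q.eval (n : ℤ)).natAbs
    · rw [if_pos hQ, if_neg hP]; linarith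
    · rw [localFactor_eq_truncFactor hp hP hQ]; simp [hP, hQ]

theorem RootBound.sum_ite_le {P : ℤ[X]} {K : ℝ} (h : RootBound P K) {p : ℕ} (k N : ℕ)
    (hp : p.Prime) :
    ∑ n ∈ Finset.Icc 1 N, (if p ^ k ∣ (P.eval (n : ℤ)).natAbs then (1 : ℝ) else 0) ≤
      K * ((N : ℝ) / (p : ℝ) ^ k + 1) := by
  rw [Finset.sum_boole]
  exact h p k N hp

theorem sum_norm_localFactor_sub_truncFactor_le {f g : ArithmeticFunction ℂ}
    (hf : ∀ n, ‖f n‖ ≤ 1) (hg : ∀ n, ‖g n‖ ≤ 1) {P Q : ℤ[X]} {K : ℝ} (hPK : RootBound P K)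
    (hQK : RootBound Q K) {p : ℕ} (hp : p.Prime) (k N : ℕ) :
    ∑ n ∈ Finset.Icc 1 N, ‖localFactor f g P Q p n - truncFactor f g P Q p k n‖ ≤
      4 * K * ((N : ℝ) / (p : ℝ) ^ (k + 1) + 1) := by
  refine (Finset.sum_le_sum fun n _ =>
    norm_localFactor_sub_truncFactor_le hf hg P Q (k := k) hp n).trans ?_
  rw [Finset.sum_add_distrib, ← Finset.mul_sum, ← Finset.mul_sum]
  linarith [hPK.sum_ite_le (k + 1) N hp, hQK.sum_ite_le (k + 1) N hp]

/-! ### Existence of the local correlations -/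

theorem corrMean_localPart (f g : ArithmeticFunction ℂ) (P Q : ℤ[X]) (p : ℕ) (x : ℝ) :
    corrMean (localPart f p) (localPart g p) P Q x =
      (∑ n ∈ Finset.Icc 1 ⌊x⌋₊, localFactor f g P Q p n) / (x : ℂ) := rfl

/-- Passing from the mean with weight `1 / ⌊x⌋₊` to that with weight `1 / x`. -/
theorem norm_div_sub_le_of_norm_sum_sub_le {S m : ℂ} {x E : ℝ} (hx : 0 < x) (hm : ‖m‖ ≤ 1)
    (h : ‖S - ⌊x⌋₊ * m‖ ≤ E) : ‖S / (x : ℂ) - m‖ ≤ (E + 1) / x := by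
  have hxc : (x : ℂ) ≠ 0 := by exact_mod_cast hx.ne'
  have h1 : S / (x : ℂ) - m = ((S - ⌊x⌋₊ * m) - ((x - ⌊x⌋₊ : ℝ) : ℂ) * m) / (x : ℂ) := by
    push_cast
    field_simp
    ring
  have h2 : ‖((x - ⌊x⌋₊ : ℝ) : ℂ) * m‖ ≤ 1 := by
    rw [norm_mul, Complex.norm_real, Real.norm_eq_abs,
      abs_of_nonneg (sub_nonneg.2 (Nat.floor_le hx.le))]
    have := Nat.lt_floor_add_one x
    nlinarith [norm_nonneg m, Nat.floor_le hx.le]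
  rw [h1, norm_div, Complex.norm_real, Real.norm_eq_abs, abs_of_pos hx]
  gcongr
  exact (norm_sub_le _ _).trans (add_le_add h h2)

theorem norm_corrMean_localPart_sub_periodMean_le {f g : ArithmeticFunction ℂ}
    (hf : ∀ n, ‖f n‖ ≤ 1) (hg : ∀ n, ‖g n‖ ≤ 1) {P Q : ℤ[X]} {K : ℝ} (hK : 0 ≤ K)
    (hPK : RootBound P K) (hQK : RootBound Q K) {p : ℕ} (hp : p.Prime) (k : ℕ) {x : ℝ}
    (hx : 0 < x) :
    ‖corrMean (localPart f p) (localPart g p) P Q x -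
        periodMean (truncFactor f g P Q p k) (p ^ k)‖ ≤
      4 * K / (p : ℝ) ^ (k + 1) + (4 * K + 2 * (p : ℝ) ^ k + 1) / x := by
  rw [corrMean_localPart]
  have h1 := norm_sum_Icc_sub_periodMean_le (pow_pos hp.pos k) (truncFactor_periodic f g P Q p k)
    (norm_truncFactor_le hf hg P Q p k) ⌊x⌋₊
  have h2 : ‖∑ n ∈ Finset.Icc 1 ⌊x⌋₊, localFactor f g P Q p n -
      ∑ n ∈ Finset.Icc 1 ⌊x⌋₊, truncFactor f g P Q p k n‖ ≤
      4 * K * ((⌊x⌋₊ : ℝ) / (p : ℝ) ^ (k + 1) + 1) := by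
    rw [← Finset.sum_sub_distrib]
    exact (norm_sum_le _ _).trans (sum_norm_localFactor_sub_truncFactor_le hf hg hPK hQK hp k _)
  have hpp : (0 : ℝ) < (p : ℝ) ^ (k + 1) := pow_pos (Nat.cast_pos.2 hp.pos) _
  have h3 := norm_div_sub_le_of_norm_sum_sub_le hx
    (norm_periodMean_le zero_le_one (norm_truncFactor_le hf hg P Q p k) (p ^ k))
    ((norm_sub_le_norm_sub_add_norm_sub _ _ _).trans (add_le_add h2 h1))
  refine h3.trans ?_
  have h4 : 4 * K * ((⌊x⌋₊ : ℝ) / (p : ℝ) ^ (k + 1)) ≤ 4 * K * (x / (p : ℝ) ^ (k + 1)) := by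
    gcongr
    exact Nat.floor_le hx.le
  calc _ ≤ (4 * K * (x / (p : ℝ) ^ (k + 1)) + 4 * K + 2 * (p : ℝ) ^ k + 1) / x := by
        refine div_le_div_of_nonneg_right ?_ hx.le
        push_cast
        linarith
    _ = _ := by field_simp; ring

theorem tendsto_corrMean_localPart {f g : ArithmeticFunction ℂ}
    (hf : ∀ n, ‖f n‖ ≤ 1) (hg : ∀ n, ‖g n‖ ≤ 1) {P Q : ℤ[X]} {K : ℝ} (hK : 0 ≤ K)
    (hPK : RootBound P K) (hQK : RootBound Q K) {p : ℕ} (hp : p.Prime) :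
    Tendsto (corrMean (localPart f p) (localPart g p) P Q) atTop (𝓝 (localCorr f g P Q p)) := by
  refine tendsto_nhds_limUnder (cauchySeq_tendsto_of_complete (Metric.cauchySeq_iff'.2 ?_))
  intro ε hε
  have hp1 : (1 : ℝ) < p := by exact_mod_cast hp.one_lt
  have ht : Tendsto (fun k : ℕ => 4 * K / (p : ℝ) ^ (k + 1)) atTop (𝓝 0) :=
    (tendsto_pow_atTop_atTop_of_one_lt hp1).comp (tendsto_add_atTop_nat 1) |>.const_div_atTop _
  obtain ⟨k, hk⟩ := (ht.eventually (gt_mem_nhds (show 0 < ε / 4 by linarith))).exists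
  have ht2 : Tendsto (fun x : ℝ => (4 * K + 2 * (p : ℝ) ^ k + 1) / x) atTop (𝓝 0) :=
    tendsto_id.const_div_atTop _
  obtain ⟨x₀, hx₀⟩ := eventually_atTop.1
    ((ht2.eventually (gt_mem_nhds (show 0 < ε / 4 by linarith))).and (eventually_gt_atTop 0))
  have key : ∀ x ≥ x₀, dist (corrMean (localPart f p) (localPart g p) P Q x)
      (periodMean (truncFactor f g P Q p k) (p ^ k)) < ε / 2 := by
    intro x hx
    rw [dist_eq_norm]
    have := norm_corrMean_localPart_sub_periodMean_le hf hg hK hPK hQK hp k (hx₀ x hx).2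
    linarith [(hx₀ x hx).1]
  refine ⟨x₀, fun x hx => ?_⟩
  have h1 := key x hx
  have h2 := key x₀ le_rfl
  rw [dist_comm] at h2
  linarith [dist_triangle (corrMean (localPart f p) (localPart g p) P Q x)
    (periodMean (truncFactor f g P Q p k) (p ^ k))
    (corrMean (localPart f p) (localPart g p) P Q x₀)]

theorem norm_localCorr_sub_periodMean_le {f g : ArithmeticFunction ℂ}
    (hf : ∀ n, ‖f n‖ ≤ 1) (hg : ∀ n, ‖g n‖ ≤ 1) {P Q : ℤ[X]} {K : ℝ} (hK : 0 ≤ K)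
    (hPK : RootBound P K) (hQK : RootBound Q K) {p : ℕ} (hp : p.Prime) (k : ℕ) :
    ‖localCorr f g P Q p - periodMean (truncFactor f g P Q p k) (p ^ k)‖ ≤
      4 * K / (p : ℝ) ^ (k + 1) := by
  have h1 := ((tendsto_corrMean_localPart hf hg hK hPK hQK hp).sub_const
    (periodMean (truncFactor f g P Q p k) (p ^ k))).norm
  have h2 : Tendsto (fun x : ℝ => 4 * K / (p : ℝ) ^ (k + 1) +
      (4 * K + 2 * (p : ℝ) ^ k + 1) / x) atTop (𝓝 (4 * K / (p : ℝ) ^ (k + 1) + 0)) :=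
    tendsto_const_nhds.add (tendsto_id.const_div_atTop _)
  rw [add_zero] at h2
  refine le_of_tendsto_of_tendsto h1 h2 ?_
  filter_upwards [eventually_gt_atTop 0] with x hx
  exact norm_corrMean_localPart_sub_periodMean_le hf hg hK hPK hQK hp k hx

theorem norm_corrMean_le {f g : ArithmeticFunction ℂ} (hf : ∀ n, ‖f n‖ ≤ 1)
    (hg : ∀ n, ‖g n‖ ≤ 1) (P Q : ℤ[X]) {x : ℝ} (hx : 0 < x) : ‖corrMean f g P Q x‖ ≤ 1 := by
  rw [corrMean, norm_div, Complex.norm_real, Real.norm_eq_abs, abs_of_pos hx, div_le_one hx]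
  calc _ ≤ ∑ n ∈ Finset.Icc 1 ⌊x⌋₊, (1 : ℝ) := by
        refine norm_sum_le_of_le _ fun n _ => ?_
        rw [norm_mul]
        exact mul_le_one₀ (hf _) (norm_nonneg _) (hg _)
    _ = ⌊x⌋₊ := by simp
    _ ≤ x := Nat.floor_le hx.le

theorem norm_localCorr_le {f g : ArithmeticFunction ℂ}
    (hf : ∀ n, ‖f n‖ ≤ 1) (hg : ∀ n, ‖g n‖ ≤ 1) {P Q : ℤ[X]} {K : ℝ} (hK : 0 ≤ K)
    (hPK : RootBound P K) (hQK : RootBound Q K) {p : ℕ} (hp : p.Prime) :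
    ‖localCorr f g P Q p‖ ≤ 1 := by
  refine le_of_tendsto (tendsto_corrMean_localPart hf hg hK hPK hQK hp).norm ?_
  filter_upwards [eventually_gt_atTop 0] with x hx
  exact norm_corrMean_le (norm_localPart_le hf p) (norm_localPart_le hg p) P Q hx

/-! ### Estimates for primes -/

theorem card_primes_le_mul_div_log {t : ℝ} (ht : 1 < t) :
    (((Finset.Icc 1 ⌊t⌋₊).filter Nat.Prime).card : ℝ) ≤ 5 * t / Real.log t := by
  have hlog : 0 < Real.log t := Real.log_pos ht
  have h0 : (0 : ℝ) ≤ t := by linarith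
  have hsq : 0 < √t := Real.sqrt_pos.2 (by linarith)
  have h1 := Chebyshev.pi_le_log4_mul_div ht
  have h2 : Nat.primeCounting ⌊t⌋₊ = ((Finset.Icc 1 ⌊t⌋₊).filter Nat.Prime).card := by
    rw [← Nat.primesLE_eq_filter_Icc_one]
    simp
  rw [h2, Real.log_sqrt h0] at h1
  refine h1.trans ?_
  have h3 : Real.log t ≤ 2 * √t := by
    have := Real.log_le_sub_one_of_pos hsq
    rw [Real.log_sqrt h0] at this
    linarith
  have h4 : √t ≤ 2 * t / Real.log t := by
    rw [le_div_iff₀ hlog]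
    nlinarith [Real.mul_self_sqrt h0]
  have h5 : Real.log 4 ≤ 1.5 := by
    have : Real.log 4 = 2 * Real.log 2 := by
      rw [show (4 : ℝ) = 2 ^ 2 by norm_num, Real.log_pow]; norm_num
    linarith [Real.log_two_lt_d9]
  have h6 : Real.log 4 * t / (Real.log t / 2) ≤ 3 * t / Real.log t := by
    rw [div_div_eq_mul_div]
    exact div_le_div_of_nonneg_right (by nlinarith) hlog.le
  calc _ ≤ 3 * t / Real.log t + 2 * t / Real.log t := add_le_add h6 h4
    _ = 5 * t / Real.log t := by ring

/-- An upper bound in Mertens' first theorem, from the factorization of `N!`. -/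
theorem sum_log_div_prime_le {N : ℕ} (hN : 1 ≤ N) :
    ∑ p ∈ (Finset.Icc 1 N).filter Nat.Prime, Real.log p / p ≤ Real.log N + Real.log 4 := by
  have hN0 : (0 : ℝ) < N := by exact_mod_cast hN
  have hthe : ∑ p ∈ (Finset.Icc 1 N).filter Nat.Prime, Real.log p ≤ Real.log 4 * N := by
    have := Chebyshev.theta_le_log4_mul_x (x := N) hN0.le
    rwa [Chebyshev.theta_eq_sum_primesLE_log, Nat.primesLE_eq_filter_Icc_one] at this
  have hfac : ∑ p ∈ (Finset.Icc 1 N).filter Nat.Prime, Real.log p * ((N / p : ℕ) : ℝ) ≤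
      N * Real.log N := by
    calc ∑ p ∈ (Finset.Icc 1 N).filter Nat.Prime, Real.log p * ((N / p : ℕ) : ℝ)
        = ∑ p ∈ (Finset.Icc 1 N).filter Nat.Prime, ∑ n ∈ Finset.Icc 1 N,
            if p ∣ n then Real.log p else 0 := by
          refine Finset.sum_congr rfl fun p _ => ?_
          rw [← Finset.sum_filter, Finset.sum_const, nsmul_eq_mul, mul_comm,
            ← Nat.Ioc_filter_dvd_card_eq_div N p]
          rfl
      _ = ∑ n ∈ Finset.Icc 1 N, ∑ p ∈ (Finset.Icc 1 N).filter Nat.Prime,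
            if p ∣ n then Real.log p else 0 := Finset.sum_comm
      _ ≤ ∑ n ∈ Finset.Icc 1 N, Real.log N := by
          refine Finset.sum_le_sum fun n hn => ?_
          have hn' := Finset.mem_Icc.1 hn
          rw [← Finset.sum_filter]
          have hsub : ((Finset.Icc 1 N).filter Nat.Prime).filter (fun p => p ∣ n) ⊆
              n.primeFactors := by
            intro p hp
            simp only [Finset.mem_filter] at hp
            exact Nat.mem_primeFactors.2 ⟨hp.1.2, hp.2, by omega⟩
          calc _ ≤ ∑ p ∈ n.primeFactors, Real.log p :=
                Finset.sum_le_sum_of_subset_of_nonneg hsub fun p _ _ => Real.log_natCast_nonneg p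
            _ = Real.log ((∏ p ∈ n.primeFactors, p : ℕ) : ℝ) := by
                rw [Nat.cast_prod, Real.log_prod]
                intro p hp
                exact_mod_cast (Nat.prime_of_mem_primeFactors hp).ne_zero
            _ ≤ Real.log N := by
                refine Real.log_le_log ?_ ?_
                · exact_mod_cast Finset.prod_pos fun p hp => (Nat.prime_of_mem_primeFactors hp).pos
                · exact_mod_cast (Nat.le_of_dvd (by omega) (Nat.prod_primeFactors_dvd n)).trans hn'.2
      _ = N * Real.log N := by simp
  have h : (N : ℝ) * ∑ p ∈ (Finset.Icc 1 N).filter Nat.Prime, Real.log p / p ≤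
      N * (Real.log N + Real.log 4) := by
    calc (N : ℝ) * ∑ p ∈ (Finset.Icc 1 N).filter Nat.Prime, Real.log p / p
        ≤ ∑ p ∈ (Finset.Icc 1 N).filter Nat.Prime,
            (Real.log p * ((N / p : ℕ) : ℝ) + Real.log p) := by
          rw [Finset.mul_sum]
          refine Finset.sum_le_sum fun p hp => ?_
          have h1 : (N : ℝ) / p ≤ ((N / p : ℕ) : ℝ) + 1 := by
            rw [← Nat.floor_div_eq_div (K := ℝ)]
            exact (Nat.lt_floor_add_one _).le
          calc (N : ℝ) * (Real.log p / p) = Real.log p * ((N : ℝ) / p) := by ring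
            _ ≤ Real.log p * (((N / p : ℕ) : ℝ) + 1) :=
                mul_le_mul_of_nonneg_left h1 (Real.log_natCast_nonneg p)
            _ = _ := by ring
      _ ≤ N * Real.log N + Real.log 4 * N := by
          rw [Finset.sum_add_distrib]
          exact add_le_add hfac hthe
      _ = _ := by ring
  exact le_of_mul_le_mul_left h hN0

theorem sum_inv_prime_le {N : ℕ} (hN : 1 ≤ N) {z : ℝ} (hz : 1 < z) (T : Finset ℕ)
    (hT : ∀ p ∈ T, p.Prime ∧ p ≤ N ∧ z ≤ p) :
    ∑ p ∈ T, (1 : ℝ) / p ≤ (Real.log N + Real.log 4) / Real.log z := by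
  have hlz := Real.log_pos hz
  rw [le_div_iff₀ hlz]
  calc (∑ p ∈ T, (1 : ℝ) / p) * Real.log z = ∑ p ∈ T, Real.log z / p := by
        rw [Finset.sum_mul]
        exact Finset.sum_congr rfl fun p _ => by ring
    _ ≤ ∑ p ∈ T, Real.log p / p := by
        refine Finset.sum_le_sum fun p hp => ?_
        have := (hT p hp).2.2
        gcongr
    _ ≤ ∑ p ∈ (Finset.Icc 1 N).filter Nat.Prime, Real.log p / p := by
        refine Finset.sum_le_sum_of_subset_of_nonneg ?_ fun p _ _ => by
          have := Real.log_natCast_nonneg p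
          positivity
        intro p hp
        have := hT p hp
        simp [this.1, this.2.1, this.1.one_le]
    _ ≤ _ := sum_log_div_prime_le hN

theorem sum_inv_sq_le {Y : ℕ} (hY : 1 ≤ Y) (T : Finset ℕ) (hT : ∀ p ∈ T, Y < p) :
    ∑ p ∈ T, (1 : ℝ) / (p : ℝ) ^ 2 ≤ 1 / Y := by
  set M := max Y (T.sup id)
  have h1 : T ⊆ Finset.Ioc Y M := by
    intro p hp
    exact Finset.mem_Ioc.2 ⟨hT p hp, le_max_of_le_right (Finset.le_sup (f := id) hp)⟩
  calc _ ≤ ∑ p ∈ Finset.Ioc Y M, (1 : ℝ) / (p : ℝ) ^ 2 :=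
        Finset.sum_le_sum_of_subset_of_nonneg h1 fun _ _ _ => by positivity
    _ = ∑ p ∈ Finset.Ioc Y M, ((p : ℝ) ^ 2)⁻¹ := by simp
    _ ≤ (Y : ℝ)⁻¹ - (M : ℝ)⁻¹ := sum_Ioc_inv_sq_le_sub (by omega) (le_max_left _ _)
    _ ≤ 1 / Y := by
        rw [one_div]
        have : (0 : ℝ) ≤ (M : ℝ)⁻¹ := by positivity
        linarith

/-! ### Products and exponentials in the unit disc -/

theorem norm_prod_le_one {ι : Type*} (s : Finset ι) {a : ι → ℂ} (ha : ∀ i ∈ s, ‖a i‖ ≤ 1) :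
    ‖∏ i ∈ s, a i‖ ≤ 1 := by
  rw [norm_prod]
  exact Finset.prod_le_one (fun _ _ => norm_nonneg _) ha

theorem norm_mul_sub_mul_le {a b c d : ℂ} (ha : ‖a‖ ≤ 1) (hd : ‖d‖ ≤ 1) :
    ‖a * b - c * d‖ ≤ ‖a - c‖ + ‖b - d‖ := by
  have : a * b - c * d = a * (b - d) + (a - c) * d := by ring
  rw [this]
  refine (norm_add_le _ _).trans ?_
  rw [norm_mul, norm_mul]
  nlinarith [norm_nonneg (b - d), norm_nonneg (a - c), norm_nonneg a, norm_nonneg d]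

theorem norm_prod_sub_prod_le {ι : Type*} (s : Finset ι) {a b : ι → ℂ}
    (ha : ∀ i ∈ s, ‖a i‖ ≤ 1) (hb : ∀ i ∈ s, ‖b i‖ ≤ 1) :
    ‖∏ i ∈ s, a i - ∏ i ∈ s, b i‖ ≤ ∑ i ∈ s, ‖a i - b i‖ := by
  classical
  induction s using Finset.induction_on with
  | empty => simp
  | insert j s hj ih =>
    rw [Finset.prod_insert hj, Finset.prod_insert hj, Finset.sum_insert hj]
    refine (norm_mul_sub_mul_le (ha j (by simp))
      (norm_prod_le_one s fun i hi => hb i (by simp [hi]))).trans ?_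
    gcongr
    exact ih (fun i hi => ha i (by simp [hi])) (fun i hi => hb i (by simp [hi]))

theorem re_sub_one_nonpos {z : ℂ} (hz : ‖z‖ ≤ 1) : (z - 1).re ≤ 0 := by
  have := (Complex.re_le_norm z).trans hz
  simpa using this

theorem norm_sub_one_sq_le {z : ℂ} (hz : ‖z‖ ≤ 1) : ‖z - 1‖ ^ 2 ≤ 2 * (1 - z.re) := by
  have h1 : ‖z - 1‖ ^ 2 = ‖z‖ ^ 2 + 1 - 2 * z.re := by
    rw [← Complex.normSq_eq_norm_sq, ← Complex.normSq_eq_norm_sq, Complex.normSq_apply,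
      Complex.normSq_apply]
    simp
    ring
  rw [h1]
  nlinarith [norm_nonneg z]

theorem norm_exp_le_one {w : ℂ} (hw : w.re ≤ 0) : ‖Complex.exp w‖ ≤ 1 := by
  rw [Complex.norm_exp]
  exact Real.exp_le_one_iff.2 hw

theorem norm_sub_exp_sub_one_le {z : ℂ} (hz : ‖z‖ ≤ 1) :
    ‖z - Complex.exp (z - 1)‖ ≤ 2 * ‖z - 1‖ ^ 2 := by
  rcases le_or_gt ‖z - 1‖ 1 with h | h
  · have := Complex.norm_exp_sub_one_sub_id_le h
    rw [norm_sub_rev] at this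
    rw [show z - Complex.exp (z - 1) = z - 1 - (Complex.exp (z - 1) - 1) by ring]
    nlinarith [sq_nonneg ‖z - 1‖]
  · have h1 := norm_sub_le z (Complex.exp (z - 1))
    have h2 := norm_exp_le_one (re_sub_one_nonpos hz)
    nlinarith

theorem norm_exp_sub_exp_le {z w : ℂ} (hz : z.re ≤ 0) (hw : w.re ≤ 0) :
    ‖Complex.exp z - Complex.exp w‖ ≤ ‖z - w‖ := by
  have hconv : Convex ℝ {u : ℂ | u.re ≤ 0} := convex_halfSpace_re_le 0
  have := hconv.norm_image_sub_le_of_norm_deriv_le (𝕜 := ℂ) (f := Complex.exp) (C := 1)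
    (fun u _ => Complex.differentiableAt_exp)
    (fun u hu => by rw [Complex.deriv_exp]; exact norm_exp_le_one hu) hw hz
  simpa using this

/-! ### The distance to the constant function -/

theorem polyDist_one_sq (P : ℤ[X]) {f : ℕ → ℂ} (hf : ∀ n, ‖f n‖ ≤ 1) (y : ℝ) {x : ℝ}
    (hx : 0 ≤ x) :
    0 ≤ ∑ p ∈ (Finset.Icc 1 ⌊x⌋₊).filter (fun p : ℕ => p.Prime ∧ y ≤ (p : ℝ)),
        (1 - (f p).re) / (p : ℝ) ∧
      0 ≤ ∑ q ∈ largePrimePowers P x, (1 - (f q).re) / x ∧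
      polyDist P (fun _ => 1) f y x ^ 2 =
        ∑ p ∈ (Finset.Icc 1 ⌊x⌋₊).filter (fun p : ℕ => p.Prime ∧ y ≤ (p : ℝ)),
          (1 - (f p).re) / (p : ℝ) + ∑ q ∈ largePrimePowers P x, (1 - (f q).re) / x := by
  have h0 : ∀ n, 0 ≤ 1 - (f n).re := fun n =>
    sub_nonneg.2 ((Complex.re_le_norm _).trans (hf n))
  have h1 : 0 ≤ ∑ p ∈ (Finset.Icc 1 ⌊x⌋₊).filter (fun p : ℕ => p.Prime ∧ y ≤ (p : ℝ)),
      (1 - (f p).re) / (p : ℝ) :=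
    Finset.sum_nonneg fun p _ => div_nonneg (h0 p) (Nat.cast_nonneg p)
  have h2 : 0 ≤ ∑ q ∈ largePrimePowers P x, (1 - (f q).re) / x :=
    Finset.sum_nonneg fun q _ => div_nonneg (h0 q) hx
  refine ⟨h1, h2, ?_⟩
  rw [polyDist, Real.sq_sqrt]
  · simp
  · simpa using add_nonneg h1 h2

theorem polyDist_nonneg (P : ℤ[X]) (f g : ℕ → ℂ) (y x : ℝ) : 0 ≤ polyDist P f g y x :=
  Real.sqrt_nonneg _

/-- By `|z - 1| ^ 2 ≤ 2 (1 - Re z)` in the unit disc, `𝔻 ^ 2` controls the second moment. -/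
theorem sum_norm_sub_one_sq_div_le_polyDist_sq (P : ℤ[X]) {f : ℕ → ℂ} (hf : ∀ n, ‖f n‖ ≤ 1)
    {x y : ℝ} (hx : 0 ≤ x) (T : Finset ℕ) (hT : ∀ p ∈ T, p.Prime ∧ p ≤ ⌊x⌋₊ ∧ y ≤ (p : ℝ)) :
    ∑ p ∈ T, ‖f p - 1‖ ^ 2 / p ≤ 2 * polyDist P (fun _ => 1) f y x ^ 2 := by
  obtain ⟨-, h2, h3⟩ := polyDist_one_sq P hf y hx
  calc ∑ p ∈ T, ‖f p - 1‖ ^ 2 / p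
      ≤ ∑ p ∈ (Finset.Icc 1 ⌊x⌋₊).filter (fun p : ℕ => p.Prime ∧ y ≤ (p : ℝ)),
          ‖f p - 1‖ ^ 2 / p := by
        refine Finset.sum_le_sum_of_subset_of_nonneg ?_ fun _ _ _ => by positivity
        intro p hp
        have := hT p hp
        simp [this.1, this.2.1, this.2.2, this.1.one_le]
    _ ≤ ∑ p ∈ (Finset.Icc 1 ⌊x⌋₊).filter (fun p : ℕ => p.Prime ∧ y ≤ (p : ℝ)),
          2 * ((1 - (f p).re) / (p : ℝ)) := by
        refine Finset.sum_le_sum fun p _ => ?_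
        rw [← mul_div_assoc]
        exact div_le_div_of_nonneg_right (norm_sub_one_sq_le (hf p)) (Nat.cast_nonneg p)
    _ ≤ _ := by
        rw [← Finset.mul_sum, h3]
        linarith

/-! ### Prime factors beyond `x` -/

theorem exists_natAbs_eval_le (P : ℤ[X]) :
    ∃ A : ℝ, ∀ n : ℕ, 1 ≤ n → ((P.eval (n : ℤ)).natAbs : ℝ) ≤ A * (n : ℝ) ^ P.natDegree := by
  refine ⟨∑ i ∈ Finset.range (P.natDegree + 1), |(P.coeff i : ℝ)|, fun n hn => ?_⟩
  have hn' : (1 : ℝ) ≤ n := by exact_mod_cast hn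
  rw [Nat.cast_natAbs, Int.cast_abs, eval_eq_sum_range]
  push_cast
  rw [Finset.sum_mul]
  refine (Finset.abs_sum_le_sum_abs _ _).trans (Finset.sum_le_sum fun i hi => ?_)
  rw [abs_mul, abs_of_nonneg (show (0 : ℝ) ≤ (n : ℝ) ^ i by positivity)]
  gcongr
  exact Nat.lt_succ_iff.1 (Finset.mem_range.1 hi)

theorem exists_card_large_primeFactors_le (P : ℤ[X]) :
    ∃ x₀ : ℝ, ∀ x : ℝ, x₀ ≤ x → ∀ n ∈ Finset.Icc 1 ⌊x⌋₊,
      ((P.eval (n : ℤ)).natAbs.primeFactors.filter fun p : ℕ => x ≤ (p : ℝ)).card ≤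
        P.natDegree + 1 := by
  obtain ⟨A, hA⟩ := exists_natAbs_eval_le P
  refine ⟨max A 2, fun x hx n hn => ?_⟩
  have hxA := (le_max_left _ _).trans hx
  have hx2 := (le_max_right _ _).trans hx
  obtain ⟨hn1, hn2⟩ := Finset.mem_Icc.1 hn
  have hnx : (n : ℝ) ≤ x := (Nat.le_floor_iff' (by omega)).1 hn2
  set m := (P.eval (n : ℤ)).natAbs with hm
  rcases eq_or_ne m 0 with h0 | h0
  · simp [h0]
  set T := m.primeFactors.filter fun p : ℕ => x ≤ (p : ℝ)
  have h1 : x ^ T.card ≤ x ^ (P.natDegree + 1) := by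
    calc x ^ T.card = ∏ p ∈ T, x := by simp
      _ ≤ ∏ p ∈ T, (p : ℝ) := Finset.prod_le_prod (fun _ _ => by linarith)
          fun p hp => (Finset.mem_filter.1 hp).2
      _ = ((∏ p ∈ T, p : ℕ) : ℝ) := by push_cast; rfl
      _ ≤ m := by
          refine Nat.cast_le.2 (Nat.le_of_dvd (Nat.pos_of_ne_zero h0) ?_)
          exact (Finset.prod_dvd_prod_of_subset _ _ _ (Finset.filter_subset _ _)).trans
            (Nat.prod_primeFactors_dvd m)
      _ ≤ A * (n : ℝ) ^ P.natDegree := hA n hn1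
      _ ≤ x * x ^ P.natDegree := by gcongr
      _ = x ^ (P.natDegree + 1) := by ring
  exact (pow_le_pow_iff_right₀ (by linarith)).1 h1

/-- The cost of the prime factors beyond `x`, by Cauchy–Schwarz over the pairs `(n, p)`. -/
theorem sum_large_primeFactors_le {P : ℤ[X]} {K : ℝ} (hK : 1 ≤ K) (hPK : RootBound P K)
    {f : ℕ → ℂ} (hf : ∀ n, ‖f n‖ ≤ 1) {x y : ℝ} (hx : 1 ≤ x)
    (hcard : ∀ n ∈ Finset.Icc 1 ⌊x⌋₊,
      ((P.eval (n : ℤ)).natAbs.primeFactors.filter fun p : ℕ => x ≤ (p : ℝ)).card ≤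
        P.natDegree + 1) :
    ∑ n ∈ Finset.Icc 1 ⌊x⌋₊,
      ∑ p ∈ (P.eval (n : ℤ)).natAbs.primeFactors.filter (fun p : ℕ => x ≤ (p : ℝ)),
        ‖f (p ^ (P.eval (n : ℤ)).natAbs.factorization p) - 1‖ ≤
      4 * K * (P.natDegree + 1) * x * polyDist P (fun _ => 1) f y x := by
  have hx0 : 0 < x := by linarith
  set S := (Finset.Icc 1 ⌊x⌋₊).sigma fun n =>
    (P.eval (n : ℤ)).natAbs.primeFactors.filter fun p : ℕ => x ≤ (p : ℝ) with hS
  set φ : (Σ _ : ℕ, ℕ) → ℕ := fun s => s.2 ^ (P.eval (s.1 : ℤ)).natAbs.factorization s.2 with hφ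
  have hfl : (⌊x⌋₊ : ℝ) ≤ x := Nat.floor_le hx0.le
  rw [Finset.sum_sigma' (Finset.Icc 1 ⌊x⌋₊) _ fun n p =>
    ‖f (p ^ (P.eval (n : ℤ)).natAbs.factorization p) - 1‖]
  change ∑ s ∈ S, ‖f (φ s) - 1‖ ≤ _
  have hScard : (S.card : ℝ) ≤ x * (P.natDegree + 1) := by
    have h1 : S.card ≤ ⌊x⌋₊ * (P.natDegree + 1) := by
      rw [hS, Finset.card_sigma]
      refine (Finset.sum_le_card_nsmul _ _ _ hcard).trans ?_
      simp
    calc (S.card : ℝ) ≤ ((⌊x⌋₊ * (P.natDegree + 1) : ℕ) : ℝ) := Nat.cast_le.2 h1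
      _ = ⌊x⌋₊ * (P.natDegree + 1) := by push_cast; ring
      _ ≤ _ := by gcongr
  have hmaps : ∀ s ∈ S, φ s ∈ largePrimePowers P x := by
    rintro ⟨n, p⟩ hs
    obtain ⟨hn, hp⟩ := Finset.mem_sigma.1 hs
    exact Finset.mem_biUnion.2 ⟨n, hn, Finset.mem_image_of_mem _ hp⟩
  have hmemS : ∀ s ∈ S, s.1 ∈ Finset.Icc 1 ⌊x⌋₊ ∧ s.2.Prime ∧ x ≤ (s.2 : ℝ) ∧
      φ s ∣ (P.eval (s.1 : ℤ)).natAbs ∧ 1 ≤ (P.eval (s.1 : ℤ)).natAbs.factorization s.2 := by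
    rintro ⟨n, p⟩ hs
    obtain ⟨hn, hp⟩ := Finset.mem_sigma.1 hs
    obtain ⟨hp1, hp2⟩ := Finset.mem_filter.1 hp
    have hpp := Nat.prime_of_mem_primeFactors hp1
    exact ⟨hn, hpp, hp2, Nat.ordProj_dvd _ _, (hpp.dvd_iff_one_le_factorization
      (Nat.mem_primeFactors.1 hp1).2.2).1 (Nat.dvd_of_mem_primeFactors hp1)⟩
  -- A prime power `q ≥ x` divides `P(n)` for at most `2 K` of the `n ≤ x`.
  have hfib : ∀ q ∈ largePrimePowers P x, ((S.filter fun s => φ s = q).card : ℝ) ≤ 2 * K := by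
    intro q hq
    obtain ⟨p, k, hp, hxp, hk, rfl, -⟩ := (mem_largePrimePowers P x q).1 hq
    have h1 : (S.filter fun s => φ s = p ^ k).card ≤
        ((Finset.Icc 1 ⌊x⌋₊).filter fun n : ℕ => p ^ k ∣ (P.eval (n : ℤ)).natAbs).card := by
      refine Finset.card_le_card_of_injOn (fun s => s.1) ?_ ?_
      · intro s hs
        obtain ⟨hs1, hs2⟩ := Finset.mem_filter.1 hs
        have := hmemS s hs1
        exact Finset.mem_filter.2 ⟨this.1, hs2 ▸ this.2.2.2.1⟩
      · rintro ⟨n, a⟩ hs ⟨n', b⟩ hs' h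
        obtain ⟨hs1, hs2⟩ := Finset.mem_filter.1 hs
        obtain ⟨hs1', hs2'⟩ := Finset.mem_filter.1 hs'
        have ha := hmemS _ hs1
        have hb := hmemS _ hs1'
        have haux : ∀ c v : ℕ, c.Prime → 1 ≤ v → c ^ v = p ^ k → c = p := by
          intro c v hc hv hcv
          refine (Nat.prime_dvd_prime_iff_eq hc hp).1 (hc.dvd_of_dvd_pow (n := k) ?_)
          rw [← hcv]
          exact dvd_pow_self _ (by omega)
        have e1 := haux a _ ha.2.1 ha.2.2.2.2 hs2
        have e2 := haux b _ hb.2.1 hb.2.2.2.2 hs2'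
        simp only at h
        rw [h, e1, e2]
    have h2 : (⌊x⌋₊ : ℝ) / (p : ℝ) ^ k ≤ 1 := by
      have hp1 : (1 : ℝ) ≤ p := by exact_mod_cast hp.one_le
      rw [div_le_one (by positivity)]
      calc (⌊x⌋₊ : ℝ) ≤ p := hfl.trans hxp
        _ ≤ (p : ℝ) ^ k := le_self_pow₀ hp1 (by omega)
    calc _ ≤ _ := Nat.cast_le.2 h1
      _ ≤ K * ((⌊x⌋₊ : ℝ) / (p : ℝ) ^ k + 1) := hPK p k _ hp
      _ ≤ K * (1 + 1) := by gcongr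
      _ = 2 * K := by ring
  have hsq : ∑ s ∈ S, ‖f (φ s) - 1‖ ^ 2 ≤ 4 * K * x * polyDist P (fun _ => 1) f y x ^ 2 := by
    obtain ⟨h1, -, h3⟩ := polyDist_one_sq P hf y hx0.le
    calc ∑ s ∈ S, ‖f (φ s) - 1‖ ^ 2
        = ∑ q ∈ largePrimePowers P x, ∑ s ∈ S.filter fun s => φ s = q, ‖f (φ s) - 1‖ ^ 2 :=
          (Finset.sum_fiberwise_of_maps_to hmaps _).symm
      _ = ∑ q ∈ largePrimePowers P x,
            ((S.filter fun s => φ s = q).card : ℝ) * ‖f q - 1‖ ^ 2 := by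
          refine Finset.sum_congr rfl fun q _ => ?_
          rw [← nsmul_eq_mul, ← Finset.sum_const]
          refine Finset.sum_congr rfl fun s hs => ?_
          rw [(Finset.mem_filter.1 hs).2]
      _ ≤ ∑ q ∈ largePrimePowers P x, 2 * K * (2 * (1 - (f q).re)) := by
          refine Finset.sum_le_sum fun q hq => ?_
          exact mul_le_mul (hfib q hq) (norm_sub_one_sq_le (hf q)) (sq_nonneg _) (by linarith)
      _ = 4 * K * x * ∑ q ∈ largePrimePowers P x, (1 - (f q).re) / x := by
          rw [Finset.mul_sum]
          refine Finset.sum_congr rfl fun q _ => ?_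
          field_simp
          ring
      _ ≤ _ := by
          rw [h3]
          have : 0 ≤ 4 * K * x := by positivity
          nlinarith
  have hD := polyDist_nonneg P (fun _ => 1) f y x
  have hd : (0 : ℝ) ≤ P.natDegree := Nat.cast_nonneg _
  refine abs_le_of_sq_le_sq' ?_ (by positivity) |>.2
  calc (∑ s ∈ S, ‖f (φ s) - 1‖) ^ 2 ≤ S.card * ∑ s ∈ S, ‖f (φ s) - 1‖ ^ 2 :=
        sq_sum_le_card_mul_sum_sq
    _ ≤ x * (P.natDegree + 1) * (4 * K * x * polyDist P (fun _ => 1) f y x ^ 2) := by gcongr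
    _ = (4 * K * (P.natDegree + 1)) * (x * polyDist P (fun _ => 1) f y x) ^ 2 := by ring
    _ ≤ (4 * K * (P.natDegree + 1)) ^ 2 * (x * polyDist P (fun _ => 1) f y x) ^ 2 := by
        gcongr
        exact le_self_pow₀ (by nlinarith) two_ne_zero
    _ = _ := by ring

/-- The value `f m` differs from the product of its local parts at `p ≤ x` only through the prime
factors beyond `x`. For `m = 0` both sides vanish, as there is a prime up to `x`. -/
theorem norm_sub_prod_localPart_le {f : ArithmeticFunction ℂ} (hm : f.IsMultiplicative)
    (hf : ∀ n, ‖f n‖ ≤ 1) {x : ℝ} (hx : 2 ≤ x) (m : ℕ) :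
    ‖f m - ∏ p ∈ (Finset.Icc 1 ⌊x⌋₊).filter Nat.Prime, localPart f p m‖ ≤
      ∑ p ∈ m.primeFactors.filter (fun p : ℕ => x ≤ (p : ℝ)),
        ‖f (p ^ m.factorization p) - 1‖ := by
  have h2 : 2 ≤ ⌊x⌋₊ := Nat.le_floor (by exact_mod_cast hx)
  rcases eq_or_ne m 0 with rfl | h0
  · have : ∏ p ∈ (Finset.Icc 1 ⌊x⌋₊).filter Nat.Prime, localPart f p 0 = 0 :=
      Finset.prod_eq_zero (i := 2) (by simp [h2, Nat.prime_two]) (by simp)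
    rw [this]
    simp
  set T := m.primeFactors.filter fun p : ℕ => ¬ p ≤ ⌊x⌋₊ with hT
  have hsmall : ∏ p ∈ (Finset.Icc 1 ⌊x⌋₊).filter Nat.Prime, localPart f p m =
      ∏ p ∈ m.primeFactors.filter (fun p : ℕ => p ≤ ⌊x⌋₊), f (p ^ m.factorization p) := by
    symm
    rw [Finset.prod_congr rfl fun p _ => (localPart_apply (f := f) (p := p) h0)]
    refine Finset.prod_subset ?_ ?_
    · intro p hp
      obtain ⟨h1, h3⟩ := Finset.mem_filter.1 hp
      have := Nat.prime_of_mem_primeFactors h1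
      simp [this, h3, this.one_le]
    · intro p hp hp'
      simp only [Finset.mem_filter, Finset.mem_Icc] at hp hp'
      have : p ∉ m.primeFactors := fun h => hp' ⟨h, hp.1.2⟩
      rw [← Nat.support_factorization, Finsupp.notMem_support_iff] at this
      rw [this, pow_zero, hm.map_one]
  have hall : f m = (∏ p ∈ m.primeFactors.filter (fun p : ℕ => p ≤ ⌊x⌋₊),
      f (p ^ m.factorization p)) * ∏ p ∈ T, f (p ^ m.factorization p) := by
    rw [hT, Finset.prod_filter_mul_prod_filter_not, hm.multiplicative_factorization f h0]
    rfl
  rw [hsmall, hall]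
  set a := ∏ p ∈ m.primeFactors.filter (fun p : ℕ => p ≤ ⌊x⌋₊), f (p ^ m.factorization p)
  have ha : ‖a‖ ≤ 1 := norm_prod_le_one _ fun p _ => hf _
  have h1 : ‖a * ∏ p ∈ T, f (p ^ m.factorization p) - a * 1‖ ≤
      ‖∏ p ∈ T, f (p ^ m.factorization p) - ∏ p ∈ T, (1 : ℂ)‖ := by
    rw [← mul_sub, norm_mul, Finset.prod_const_one]
    exact mul_le_of_le_one_left (norm_nonneg _) ha
  rw [mul_one] at h1
  refine (h1.trans (norm_prod_sub_prod_le _ (fun p _ => hf _) (fun p _ => by simp))).trans ?_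
  refine Finset.sum_le_sum_of_subset_of_nonneg ?_ fun _ _ _ => norm_nonneg _
  intro p hp
  obtain ⟨h3, h4⟩ := Finset.mem_filter.1 hp
  refine Finset.mem_filter.2 ⟨h3, ?_⟩
  exact ((Nat.floor_lt (by linarith)).1 (not_le.1 h4)).le

/-! ### The factors at primes to the first order -/

theorem norm_apply_gcd_sub_one_le {f : ArithmeticFunction ℂ} (hf1 : f 1 = 1) {p : ℕ}
    (hp : p.Prime) (m : ℕ) :
    ‖f (m.gcd (p ^ 1)) - 1‖ ≤ ‖f p - 1‖ * (if p ^ 1 ∣ m then 1 else 0) := by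
  rw [pow_one]
  split_ifs with h
  · rw [Nat.gcd_eq_right h, mul_one]
  · rw [((Nat.Prime.coprime_iff_not_dvd hp).2 h).symm.gcd_eq_one, hf1]
    simp

section FirstOrder

variable {f g : ArithmeticFunction ℂ} {P Q : ℤ[X]} {K : ℝ} {p : ℕ}

theorem norm_truncFactor_one_sub_one_le (hf1 : f 1 = 1) (hg1 : g 1 = 1) (hf : ∀ n, ‖f n‖ ≤ 1)
    (hp : p.Prime) (n : ℕ) :
    ‖truncFactor f g P Q p 1 n - 1‖ ≤
      ‖f p - 1‖ * (if p ^ 1 ∣ (P.eval (n : ℤ)).natAbs then 1 else 0) +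
        ‖g p - 1‖ * (if p ^ 1 ∣ (Q.eval (n : ℤ)).natAbs then 1 else 0) := by
  have h := norm_mul_sub_mul_le (a := f ((P.eval (n : ℤ)).natAbs.gcd (p ^ 1)))
    (b := g ((Q.eval (n : ℤ)).natAbs.gcd (p ^ 1))) (c := 1) (d := 1) (hf _) (by simp)
  rw [mul_one] at h
  exact h.trans (add_le_add (norm_apply_gcd_sub_one_le hf1 hp _)
    (norm_apply_gcd_sub_one_le hg1 hp _))

theorem sum_norm_truncFactor_one_sub_one_le (hf1 : f 1 = 1) (hg1 : g 1 = 1)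
    (hf : ∀ n, ‖f n‖ ≤ 1) (hK : 0 ≤ K) (hPK : RootBound P K) (hQK : RootBound Q K)
    (hp : p.Prime) {N : ℕ} (hN : p ≤ N) :
    ∑ n ∈ Finset.Icc 1 N, ‖truncFactor f g P Q p 1 n - 1‖ ≤
      N * (2 * K * ((‖f p - 1‖ + ‖g p - 1‖) / p)) := by
  have hp0 : (0 : ℝ) < p := Nat.cast_pos.2 hp.pos
  have h1 : (1 : ℝ) ≤ N / p := by rw [one_le_div hp0]; exact_mod_cast hN
  have hP := hPK.sum_ite_le 1 N hp
  have hQ := hQK.sum_ite_le 1 N hp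
  rw [pow_one (p : ℝ)] at hP hQ
  calc _ ≤ _ := Finset.sum_le_sum fun n _ => norm_truncFactor_one_sub_one_le hf1 hg1 hf hp n
    _ ≤ ‖f p - 1‖ * (K * ((N : ℝ) / p + 1)) + ‖g p - 1‖ * (K * ((N : ℝ) / p + 1)) := by
        rw [Finset.sum_add_distrib, ← Finset.mul_sum, ← Finset.mul_sum]
        gcongr
    _ = (‖f p - 1‖ + ‖g p - 1‖) * (K * ((N : ℝ) / p + 1)) := by ring
    _ ≤ (‖f p - 1‖ + ‖g p - 1‖) * (K * ((N : ℝ) / p + N / p)) := by gcongr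
    _ = _ := by ring

theorem sum_norm_truncFactor_one_sub_one_sq_le (hf1 : f 1 = 1) (hg1 : g 1 = 1)
    (hf : ∀ n, ‖f n‖ ≤ 1) (hK : 0 ≤ K) (hPK : RootBound P K) (hQK : RootBound Q K)
    (hp : p.Prime) {N : ℕ} (hN : p ≤ N) :
    ∑ n ∈ Finset.Icc 1 N, ‖truncFactor f g P Q p 1 n - 1‖ ^ 2 ≤
      N * (4 * K * ((‖f p - 1‖ ^ 2 + ‖g p - 1‖ ^ 2) / p)) := by
  have hp0 : (0 : ℝ) < p := Nat.cast_pos.2 hp.pos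
  have h1 : (1 : ℝ) ≤ N / p := by rw [one_le_div hp0]; exact_mod_cast hN
  have hP := hPK.sum_ite_le 1 N hp
  have hQ := hQK.sum_ite_le 1 N hp
  rw [pow_one (p : ℝ)] at hP hQ
  calc _ ≤ ∑ n ∈ Finset.Icc 1 N,
        (2 * ‖f p - 1‖ ^ 2 * (if p ^ 1 ∣ (P.eval (n : ℤ)).natAbs then 1 else 0) +
          2 * ‖g p - 1‖ ^ 2 * (if p ^ 1 ∣ (Q.eval (n : ℤ)).natAbs then 1 else 0)) := by
        refine Finset.sum_le_sum fun n _ => ?_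
        refine (pow_le_pow_left₀ (norm_nonneg _)
          (norm_truncFactor_one_sub_one_le hf1 hg1 hf hp n) 2).trans ?_
        split_ifs <;> nlinarith [sq_nonneg (‖f p - 1‖ - ‖g p - 1‖), sq_nonneg ‖f p - 1‖,
          sq_nonneg ‖g p - 1‖]
    _ ≤ 2 * ‖f p - 1‖ ^ 2 * (K * ((N : ℝ) / p + 1)) +
          2 * ‖g p - 1‖ ^ 2 * (K * ((N : ℝ) / p + 1)) := by
        rw [Finset.sum_add_distrib, ← Finset.mul_sum, ← Finset.mul_sum]
        gcongr
    _ = 2 * (‖f p - 1‖ ^ 2 + ‖g p - 1‖ ^ 2) * (K * ((N : ℝ) / p + 1)) := by ring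
    _ ≤ 2 * (‖f p - 1‖ ^ 2 + ‖g p - 1‖ ^ 2) * (K * ((N : ℝ) / p + N / p)) := by gcongr
    _ = _ := by ring

theorem norm_periodMean_truncFactor_one_sub_one_le (hf1 : f 1 = 1) (hg1 : g 1 = 1)
    (hf : ∀ n, ‖f n‖ ≤ 1) (hK : 0 ≤ K) (hPK : RootBound P K) (hQK : RootBound Q K)
    (hp : p.Prime) :
    ‖periodMean (truncFactor f g P Q p 1) (p ^ 1) - 1‖ ≤
      2 * K * ((‖f p - 1‖ + ‖g p - 1‖) / p) := by
  have hp0 : (0 : ℝ) < p := Nat.cast_pos.2 hp.pos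
  have hpc : (p : ℂ) ≠ 0 := by exact_mod_cast hp.ne_zero
  have h1 : periodMean (truncFactor f g P Q p 1) (p ^ 1) - 1 =
      (∑ n ∈ Finset.Icc 1 p, (truncFactor f g P Q p 1 n - 1)) / p := by
    have h := sum_range_add_of_periodic (truncFactor_periodic f g P Q p 1) 1
    rw [pow_one] at h
    rw [periodMean, pow_one, Finset.sum_sub_distrib, sum_Icc_one_eq_sum_range, h]
    simp [sub_div, hpc]
  rw [h1, norm_div, Complex.norm_natCast, div_le_iff₀ hp0]
  refine (norm_sum_le _ _).trans
    ((sum_norm_truncFactor_one_sub_one_le hf1 hg1 hf hK hPK hQK hp le_rfl).trans ?_)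
  rw [mul_comm]

end FirstOrder

/-! ### A Turán–Kubilius inequality -/

/-- Variance of a sum of mean-zero functions of distinct prime periods `p ≤ Z`: up to `8 Z ^ 4`,
only the diagonal contributes. -/
theorem sum_norm_sum_sq_le_of_periodic {T : Finset ℕ} {Z : ℕ} (hT : ∀ p ∈ T, p.Prime ∧ p ≤ Z)
    {c : ℕ → ℕ → ℂ} (hc : ∀ p ∈ T, Function.Periodic (c p) p)
    (hc0 : ∀ p ∈ T, periodMean (c p) p = 0) (hc2 : ∀ p ∈ T, ∀ n, ‖c p n‖ ≤ 2) (N : ℕ) :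
    ∑ n ∈ Finset.Icc 1 N, ‖∑ p ∈ T, c p n‖ ^ 2 ≤
      ∑ p ∈ T, ∑ n ∈ Finset.Icc 1 N, ‖c p n‖ ^ 2 + 8 * (Z : ℝ) ^ 4 := by
  have hTc : (T.card : ℝ) ≤ Z := by
    have : T ⊆ Finset.Icc 1 Z := fun p hp =>
      Finset.mem_Icc.2 ⟨(hT p hp).1.one_le, (hT p hp).2⟩
    have := Finset.card_le_card this
    rw [Nat.card_Icc, Nat.add_sub_cancel] at this
    exact_mod_cast this
  have hpair : ∀ p ∈ T, ∀ q ∈ T,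
      ‖∑ n ∈ Finset.Icc 1 N, c p n * starRingEnd ℂ (c q n)‖ ≤
        (if p = q then ∑ n ∈ Finset.Icc 1 N, ‖c p n‖ ^ 2 else 0) + 8 * (Z : ℝ) ^ 2 := by
    intro p hp q hq
    split_ifs with hpq
    · subst hpq
      refine (norm_sum_le _ _).trans ?_
      have : (0 : ℝ) ≤ 8 * (Z : ℝ) ^ 2 := by positivity
      refine le_add_of_le_of_nonneg (le_of_eq ?_) this
      refine Finset.sum_congr rfl fun n _ => ?_
      rw [norm_mul, RCLike.norm_conj, sq]
    · have hpp := (hT p hp).1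
      have hqq := (hT q hq).1
      have hcop : p.Coprime q := (Nat.coprime_primes hpp hqq).2 hpq
      have hper : Function.Periodic (fun n => starRingEnd ℂ (c q n)) q := fun n => by
        simp only [hc q hq n]
      have hper2 : Function.Periodic (fun n => c p n * starRingEnd ℂ (c q n)) (p * q) := by
        intro n
        have h1 := (hc p hp).nat_mul q n
        have h2 := hper.nat_mul p n
        simp only [Nat.cast_id] at h1 h2
        rw [mul_comm q p] at h1
        exact congrArg₂ (· * ·) h1 h2
      have h := norm_sum_Icc_sub_periodMean_le (Nat.mul_pos hpp.pos hqq.pos) hper2 (B := 4)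
        (fun n => by
          rw [norm_mul, RCLike.norm_conj]
          nlinarith [hc2 p hp n, hc2 q hq n, norm_nonneg (c p n), norm_nonneg (c q n)]) N
      rw [periodMean_mul hpp.pos hqq.pos (hc p hp) hper hcop, hc0 p hp, zero_mul, mul_zero,
        sub_zero] at h
      refine h.trans ?_
      have h1 : (p : ℝ) ≤ Z := by exact_mod_cast (hT p hp).2
      have h2 : (q : ℝ) ≤ Z := by exact_mod_cast (hT q hq).2
      push_cast
      have : (p : ℝ) * q ≤ Z * Z := by gcongr
      nlinarith
  have hexp : ((∑ n ∈ Finset.Icc 1 N, ‖∑ p ∈ T, c p n‖ ^ 2 : ℝ) : ℂ) =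
      ∑ p ∈ T, ∑ q ∈ T, ∑ n ∈ Finset.Icc 1 N, c p n * starRingEnd ℂ (c q n) := by
    push_cast
    calc _ = ∑ n ∈ Finset.Icc 1 N, ∑ p ∈ T, ∑ q ∈ T, c p n * starRingEnd ℂ (c q n) := by
          refine Finset.sum_congr rfl fun n _ => ?_
          rw [← Complex.mul_conj', map_sum, Finset.sum_mul_sum]
      _ = _ := by
          rw [Finset.sum_comm]
          exact Finset.sum_congr rfl fun p _ => Finset.sum_comm
  have hnn : 0 ≤ ∑ n ∈ Finset.Icc 1 N, ‖∑ p ∈ T, c p n‖ ^ 2 :=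
    Finset.sum_nonneg fun _ _ => by positivity
  calc ∑ n ∈ Finset.Icc 1 N, ‖∑ p ∈ T, c p n‖ ^ 2
      = ‖((∑ n ∈ Finset.Icc 1 N, ‖∑ p ∈ T, c p n‖ ^ 2 : ℝ) : ℂ)‖ := by
        rw [Complex.norm_real, Real.norm_of_nonneg hnn]
    _ ≤ ∑ p ∈ T, ∑ q ∈ T,
          ((if p = q then ∑ n ∈ Finset.Icc 1 N, ‖c p n‖ ^ 2 else 0) + 8 * (Z : ℝ) ^ 2) := by
        rw [hexp]
        exact norm_sum_le_of_le _ fun p hp => norm_sum_le_of_le _ fun q hq => hpair p hp q hq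
    _ = ∑ p ∈ T, ∑ n ∈ Finset.Icc 1 N, ‖c p n‖ ^ 2 + T.card * (T.card * (8 * (Z : ℝ) ^ 2)) := by
        simp only [Finset.sum_add_distrib, Finset.sum_ite_eq, Finset.sum_const, nsmul_eq_mul]
        congr 1
        refine Finset.sum_congr rfl fun p hp => if_pos hp
    _ ≤ ∑ p ∈ T, ∑ n ∈ Finset.Icc 1 N, ‖c p n‖ ^ 2 + Z * (Z * (8 * (Z : ℝ) ^ 2)) := by gcongr
    _ = _ := by ring

/-- Concentration of the product over medium primes. Both the product and its expected value are
compared with exponentials of sums, which are close by the Turán–Kubilius inequality; since all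
exponents have nonpositive real part, the exponential does not increase distances. -/
theorem sum_norm_prod_truncFactor_sub_prod_periodMean_le {f g : ArithmeticFunction ℂ}
    {P Q : ℤ[X]} {K : ℝ} (hf1 : f 1 = 1) (hg1 : g 1 = 1) (hf : ∀ n, ‖f n‖ ≤ 1)
    (hg : ∀ n, ‖g n‖ ≤ 1) (hK : 1 ≤ K) (hPK : RootBound P K) (hQK : RootBound Q K)
    {T : Finset ℕ} {Z N : ℕ} (hZN : Z ≤ N) (hT : ∀ p ∈ T, p.Prime ∧ p ≤ Z) {V : ℝ}
    (hV : ∑ p ∈ T, (‖f p - 1‖ ^ 2 + ‖g p - 1‖ ^ 2) / p ≤ V) :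
    ∑ n ∈ Finset.Icc 1 N, ‖∏ p ∈ T, truncFactor f g P Q p 1 n -
        ∏ p ∈ T, periodMean (truncFactor f g P Q p 1) (p ^ 1)‖ ≤
      N * (24 * K ^ 2 * V) + √(N * (N * (24 * K ^ 2 * V) + 8 * (Z : ℝ) ^ 4)) := by
  have hK0 : 0 ≤ K := by linarith
  set u := fun p n => truncFactor f g P Q p 1 n with hu
  set m := fun p => periodMean (truncFactor f g P Q p 1) (p ^ 1) with hm
  set v := fun p : ℕ => (‖f p - 1‖ ^ 2 + ‖g p - 1‖ ^ 2) / (p : ℝ) with hv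
  have hu1 : ∀ p n, ‖u p n‖ ≤ 1 := fun p n => norm_truncFactor_le hf hg P Q p 1 n
  have hm1 : ∀ p, ‖m p‖ ≤ 1 := fun p => norm_periodMean_le zero_le_one (hu1 p) _
  have hmsq : ∀ p ∈ T, ‖m p - 1‖ ^ 2 ≤ 8 * K ^ 2 * v p := by
    intro p hp
    have hp1 : (1 : ℝ) ≤ p := by exact_mod_cast (hT p hp).1.one_le
    have h1 := norm_periodMean_truncFactor_one_sub_one_le hf1 hg1 hf hK0 hPK hQK (hT p hp).1
    calc ‖m p - 1‖ ^ 2 ≤ (2 * K * ((‖f p - 1‖ + ‖g p - 1‖) / p)) ^ 2 :=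
          pow_le_pow_left₀ (norm_nonneg _) h1 2
      _ = 4 * K ^ 2 * ((‖f p - 1‖ + ‖g p - 1‖) ^ 2 / (p : ℝ) ^ 2) := by ring
      _ ≤ 4 * K ^ 2 * ((2 * (‖f p - 1‖ ^ 2 + ‖g p - 1‖ ^ 2)) / (p : ℝ)) := by
          gcongr
          · nlinarith [sq_nonneg (‖f p - 1‖ - ‖g p - 1‖)]
          · exact le_self_pow₀ hp1 two_ne_zero
      _ = 8 * K ^ 2 * v p := by rw [hv]; ring
  have husq : ∀ p ∈ T, ∑ n ∈ Finset.Icc 1 N, ‖u p n - 1‖ ^ 2 ≤ N * (4 * K * v p) := fun p hp =>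
    sum_norm_truncFactor_one_sub_one_sq_le hf1 hg1 hf hK0 hPK hQK (hT p hp).1
      ((hT p hp).2.trans hZN)
  have hv0 : ∀ p, 0 ≤ v p := fun p => by positivity
  have hV0 : 0 ≤ V := (Finset.sum_nonneg fun p _ => hv0 p).trans hV
  have hKK : K ≤ K ^ 2 := le_self_pow₀ hK two_ne_zero
  set H := ∑ p ∈ T, (m p - 1) with hH
  set h := fun n => ∑ p ∈ T, (u p n - 1) with hh
  have hre : ∀ a : ℕ → ℂ, (∀ p, ‖a p‖ ≤ 1) → (∑ p ∈ T, (a p - 1)).re ≤ 0 := by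
    intro a ha
    rw [Complex.re_sum]
    exact Finset.sum_nonpos fun p _ => re_sub_one_nonpos (ha p)
  have hprod : ∀ a : ℕ → ℂ, (∀ p, ‖a p‖ ≤ 1) →
      ‖∏ p ∈ T, a p - Complex.exp (∑ p ∈ T, (a p - 1))‖ ≤ ∑ p ∈ T, 2 * ‖a p - 1‖ ^ 2 := by
    intro a ha
    rw [Complex.exp_sum]
    refine (norm_prod_sub_prod_le T (fun p _ => ha p)
      (fun p _ => norm_exp_le_one (re_sub_one_nonpos (ha p)))).trans ?_
    exact Finset.sum_le_sum fun p _ => norm_sub_exp_sub_one_le (ha p)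
  have hvar : ∑ n ∈ Finset.Icc 1 N, ‖h n - H‖ ^ 2 ≤ N * (24 * K ^ 2 * V) + 8 * (Z : ℝ) ^ 4 := by
    have h1 := sum_norm_sum_sq_le_of_periodic hT (c := fun p n => u p n - m p) ?_ ?_ ?_ N
    · have h2 : ∀ n, ∑ p ∈ T, (u p n - m p) = h n - H := by
        intro n
        rw [hh, hH, ← Finset.sum_sub_distrib]
        exact Finset.sum_congr rfl fun p _ => by ring
      simp only [h2] at h1
      refine h1.trans ?_
      gcongr
      calc ∑ p ∈ T, ∑ n ∈ Finset.Icc 1 N, ‖u p n - m p‖ ^ 2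
          ≤ ∑ p ∈ T, N * (24 * K ^ 2 * v p) := by
            refine Finset.sum_le_sum fun p hp => ?_
            calc ∑ n ∈ Finset.Icc 1 N, ‖u p n - m p‖ ^ 2
                ≤ ∑ n ∈ Finset.Icc 1 N, (2 * ‖u p n - 1‖ ^ 2 + 2 * ‖m p - 1‖ ^ 2) := by
                  refine Finset.sum_le_sum fun n _ => ?_
                  have h3 : ‖u p n - m p‖ ≤ ‖u p n - 1‖ + ‖m p - 1‖ := by
                    rw [show u p n - m p = (u p n - 1) - (m p - 1) by ring]
                    exact norm_sub_le _ _
                  have := pow_le_pow_left₀ (norm_nonneg _) h3 2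
                  nlinarith [sq_nonneg (‖u p n - 1‖ - ‖m p - 1‖)]
              _ = 2 * ∑ n ∈ Finset.Icc 1 N, ‖u p n - 1‖ ^ 2 + N * (2 * ‖m p - 1‖ ^ 2) := by
                  rw [Finset.sum_add_distrib, ← Finset.mul_sum]
                  simp
              _ ≤ 2 * (N * (4 * K ^ 2 * v p)) + N * (2 * (8 * K ^ 2 * v p)) := by
                  gcongr
                  · refine (husq p hp).trans ?_
                    have := hv0 p
                    gcongr
                  · exact hmsq p hp
              _ = N * (24 * K ^ 2 * v p) := by ring
        _ = N * (24 * K ^ 2 * ∑ p ∈ T, v p) := by rw [← Finset.mul_sum, ← Finset.mul_sum]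
        _ ≤ N * (24 * K ^ 2 * V) := by gcongr
    · intro p _ n
      have := truncFactor_periodic f g P Q p 1 n
      rw [pow_one] at this
      exact congrArg (· - m p) this
    · intro p hp
      have hpc : (p : ℂ) ≠ 0 := by exact_mod_cast (hT p hp).1.ne_zero
      simp only [periodMean, Finset.sum_sub_distrib, hm, pow_one, hu]
      simp [mul_div_cancel₀ _ hpc]
    · intro p _ n
      exact (norm_sub_le _ _).trans (by linarith [hu1 p n, hm1 p])
  have hdev : ∑ n ∈ Finset.Icc 1 N, ‖h n - H‖ ≤
      √(N * (N * (24 * K ^ 2 * V) + 8 * (Z : ℝ) ^ 4)) := by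
    refine Real.le_sqrt_of_sq_le ?_
    refine (sq_sum_le_card_mul_sum_sq).trans ?_
    rw [Nat.card_Icc, Nat.add_sub_cancel]
    gcongr
  have hpt : ∀ n, ‖∏ p ∈ T, u p n - ∏ p ∈ T, m p‖ ≤
      ∑ p ∈ T, 2 * ‖u p n - 1‖ ^ 2 + ‖h n - H‖ + ∑ p ∈ T, 2 * ‖m p - 1‖ ^ 2 := by
    intro n
    have e1 := hprod (fun p => u p n) (fun p => hu1 p n)
    have e2 := norm_exp_sub_exp_le (hre (fun p => u p n) fun p => hu1 p n) (hre m hm1)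
    have e3 := hprod m hm1
    rw [norm_sub_rev] at e3
    calc _ = ‖(∏ p ∈ T, u p n - Complex.exp (h n)) + (Complex.exp (h n) - Complex.exp H) +
          (Complex.exp H - ∏ p ∈ T, m p)‖ := by ring_nf
      _ ≤ _ := norm_add₃_le
      _ ≤ _ := add_le_add (add_le_add e1 e2) e3
  calc _ ≤ ∑ n ∈ Finset.Icc 1 N, (∑ p ∈ T, 2 * ‖u p n - 1‖ ^ 2 + ‖h n - H‖ +
        ∑ p ∈ T, 2 * ‖m p - 1‖ ^ 2) := Finset.sum_le_sum fun n _ => hpt n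
    _ = ∑ p ∈ T, (2 * ∑ n ∈ Finset.Icc 1 N, ‖u p n - 1‖ ^ 2 + N * (2 * ‖m p - 1‖ ^ 2)) +
          ∑ n ∈ Finset.Icc 1 N, ‖h n - H‖ := by
        rw [Finset.sum_add_distrib, Finset.sum_add_distrib, Finset.sum_comm,
          Finset.sum_add_distrib]
        simp only [Finset.mul_sum, Finset.sum_const, Nat.card_Icc, Nat.add_sub_cancel,
          nsmul_eq_mul]
        ring
    _ ≤ ∑ p ∈ T, N * (24 * K ^ 2 * v p) + √(N * (N * (24 * K ^ 2 * V) + 8 * (Z : ℝ) ^ 4)) := by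
        refine add_le_add (Finset.sum_le_sum fun p hp => ?_) hdev
        calc _ ≤ 2 * (N * (4 * K ^ 2 * v p)) + N * (2 * (8 * K ^ 2 * v p)) := by
              gcongr
              · refine (husq p hp).trans ?_
                have := hv0 p
                gcongr
              · exact hmsq p hp
          _ = _ := by ring
    _ = N * (24 * K ^ 2 * ∑ p ∈ T, v p) + √(N * (N * (24 * K ^ 2 * V) + 8 * (Z : ℝ) ^ 4)) := by
        rw [← Finset.mul_sum, ← Finset.mul_sum]
    _ ≤ _ := by gcongr

/-! ### Truncation of the local factors -/

/-- The exponent at which the factor at `p` is truncated: for `p ≤ Y` the largest `k` with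
`p ^ k ≤ Y ^ 2`, and `1` for `p > Y`. -/
def truncExp (Y p : ℕ) : ℕ := if p ≤ Y then Nat.log p (Y ^ 2) else 1

theorem sum_inv_pow_truncExp_le {Y : ℕ} (hY : 1 ≤ Y) (T : Finset ℕ) (hT : ∀ p ∈ T, p.Prime) :
    ∑ p ∈ T, (1 : ℝ) / (p : ℝ) ^ (truncExp Y p + 1) ≤ 2 / Y := by
  have hY0 : (0 : ℝ) < Y := by exact_mod_cast hY
  rw [← Finset.sum_filter_add_sum_filter_not T (fun p => p ≤ Y)]
  have h1 : ∑ p ∈ T.filter (fun p => p ≤ Y), (1 : ℝ) / (p : ℝ) ^ (truncExp Y p + 1) ≤ 1 / Y := by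
    have hcard : ((T.filter (fun p => p ≤ Y)).card : ℝ) ≤ Y := by
      have : T.filter (fun p => p ≤ Y) ⊆ Finset.Icc 1 Y := fun p hp => by
        have := Finset.mem_filter.1 hp
        exact Finset.mem_Icc.2 ⟨(hT p this.1).one_le, this.2⟩
      have := Finset.card_le_card this
      rw [Nat.card_Icc, Nat.add_sub_cancel] at this
      exact_mod_cast this
    calc _ ≤ ∑ p ∈ T.filter (fun p => p ≤ Y), (1 : ℝ) / (Y : ℝ) ^ 2 := by
          refine Finset.sum_le_sum fun p hp => ?_
          have hp' := Finset.mem_filter.1 hp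
          have h := Nat.lt_pow_succ_log_self (hT p hp'.1).one_lt (Y ^ 2)
          rw [truncExp, if_pos hp'.2]
          have h2 : (Y : ℝ) ^ 2 ≤ (p : ℝ) ^ (Nat.log p (Y ^ 2) + 1) := by exact_mod_cast h.le
          gcongr
      _ = (T.filter (fun p => p ≤ Y)).card * (1 / (Y : ℝ) ^ 2) := by simp
      _ ≤ Y * (1 / (Y : ℝ) ^ 2) := by gcongr
      _ = 1 / Y := by field_simp
  have h2 : ∑ p ∈ T.filter (fun p => ¬ p ≤ Y), (1 : ℝ) / (p : ℝ) ^ (truncExp Y p + 1) ≤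
      1 / Y := by
    refine le_trans (le_of_eq ?_) (sum_inv_sq_le hY (T.filter (fun p => ¬ p ≤ Y))
      fun p hp => not_le.1 (Finset.mem_filter.1 hp).2)
    refine Finset.sum_congr rfl fun p hp => ?_
    rw [truncExp, if_neg (Finset.mem_filter.1 hp).2]
  calc _ ≤ 1 / (Y : ℝ) + 1 / Y := add_le_add h1 h2
    _ = 2 / Y := by ring

/-- The common period of the truncated factors at the primes up to `Y` is at most `e ^ (10 Y)`. -/
theorem prod_pow_truncExp_le {Y : ℕ} (hY : 2 ≤ Y) :
    ((∏ p ∈ (Finset.Icc 1 Y).filter Nat.Prime, p ^ truncExp Y p : ℕ) : ℝ) ≤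
      Real.exp (10 * Y) := by
  have hY1 : (1 : ℝ) < Y := by exact_mod_cast hY
  have hlog := Real.log_pos hY1
  have hc := card_primes_le_mul_div_log hY1
  rw [Nat.floor_natCast] at hc
  push_cast
  calc _ ≤ ∏ p ∈ (Finset.Icc 1 Y).filter Nat.Prime, (Y : ℝ) ^ 2 := by
        refine Finset.prod_le_prod (fun _ _ => by positivity) fun p hp => ?_
        obtain ⟨h1, -⟩ := Finset.mem_filter.1 hp
        rw [truncExp, if_pos (Finset.mem_Icc.1 h1).2]
        exact_mod_cast Nat.pow_log_le_self p (by positivity)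
    _ = Real.exp (((Finset.Icc 1 Y).filter Nat.Prime).card * (2 * Real.log Y)) := by
        rw [Finset.prod_const, Real.exp_nat_mul, ← Real.log_rpow (by linarith),
          Real.exp_log (by positivity)]
        norm_cast
    _ ≤ Real.exp (5 * Y / Real.log Y * (2 * Real.log Y)) := by gcongr
    _ = Real.exp (10 * Y) := by
        congr 1
        field_simp
        norm_num

section Ranges

variable {f g : ArithmeticFunction ℂ} {P Q : ℤ[X]} {K : ℝ}

theorem sum_norm_prod_localFactor_sub_prod_truncFactor_le (hf : ∀ n, ‖f n‖ ≤ 1)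
    (hg : ∀ n, ‖g n‖ ≤ 1) (hK : 0 ≤ K) (hPK : RootBound P K) (hQK : RootBound Q K)
    {Y : ℕ} (hY : 1 ≤ Y) (T : Finset ℕ) (hT : ∀ p ∈ T, p.Prime) (N : ℕ) :
    ∑ n ∈ Finset.Icc 1 N, ‖∏ p ∈ T, localFactor f g P Q p n -
        ∏ p ∈ T, truncFactor f g P Q p (truncExp Y p) n‖ ≤
      4 * K * (N * (2 / Y) + T.card) := by
  calc _ ≤ ∑ n ∈ Finset.Icc 1 N, ∑ p ∈ T,
        ‖localFactor f g P Q p n - truncFactor f g P Q p (truncExp Y p) n‖ :=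
        Finset.sum_le_sum fun n _ => norm_prod_sub_prod_le T
          (fun p _ => norm_localFactor_le hf hg P Q p n)
          (fun p _ => norm_truncFactor_le hf hg P Q p _ n)
    _ = ∑ p ∈ T, ∑ n ∈ Finset.Icc 1 N,
        ‖localFactor f g P Q p n - truncFactor f g P Q p (truncExp Y p) n‖ := Finset.sum_comm
    _ ≤ ∑ p ∈ T, 4 * K * ((N : ℝ) / (p : ℝ) ^ (truncExp Y p + 1) + 1) :=
        Finset.sum_le_sum fun p hp =>
          sum_norm_localFactor_sub_truncFactor_le hf hg hPK hQK (hT p hp) _ N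
    _ = 4 * K * (N * ∑ p ∈ T, (1 : ℝ) / (p : ℝ) ^ (truncExp Y p + 1) + T.card) := by
        rw [← Finset.mul_sum, Finset.sum_add_distrib, Finset.mul_sum]
        simp [div_eq_mul_inv]
    _ ≤ _ := by
        gcongr
        exact sum_inv_pow_truncExp_le hY T hT

theorem norm_prod_localCorr_sub_prod_periodMean_le (hf : ∀ n, ‖f n‖ ≤ 1)
    (hg : ∀ n, ‖g n‖ ≤ 1) (hK : 0 ≤ K) (hPK : RootBound P K) (hQK : RootBound Q K)
    {Y : ℕ} (hY : 1 ≤ Y) (T : Finset ℕ) (hT : ∀ p ∈ T, p.Prime) :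
    ‖∏ p ∈ T, localCorr f g P Q p -
        ∏ p ∈ T, periodMean (truncFactor f g P Q p (truncExp Y p)) (p ^ truncExp Y p)‖ ≤
      4 * K * (2 / Y) := by
  refine (norm_prod_sub_prod_le T
    (fun p hp => norm_localCorr_le hf hg hK hPK hQK (hT p hp))
    (fun p _ => norm_periodMean_le zero_le_one (norm_truncFactor_le hf hg P Q p _) _)).trans ?_
  calc _ ≤ ∑ p ∈ T, 4 * K / (p : ℝ) ^ (truncExp Y p + 1) := Finset.sum_le_sum fun p hp =>
        norm_localCorr_sub_periodMean_le hf hg hK hPK hQK (hT p hp) _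
    _ = 4 * K * ∑ p ∈ T, (1 : ℝ) / (p : ℝ) ^ (truncExp Y p + 1) := by
        rw [Finset.mul_sum]
        exact Finset.sum_congr rfl fun p _ => by ring
    _ ≤ _ := by
        gcongr
        exact sum_inv_pow_truncExp_le hY T hT

/-! ### Ranges of primes -/

/-- The product over the small primes is periodic, so its sum over `n ≤ N` is `N` times the product
of the means, with an error of at most twice the period. -/
theorem norm_sum_prod_small_sub_le (hf : ∀ n, ‖f n‖ ≤ 1) (hg : ∀ n, ‖g n‖ ≤ 1) {Y : ℕ}
    (hY : 2 ≤ Y) (N : ℕ) :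
    ‖∑ n ∈ Finset.Icc 1 N, ∏ p ∈ (Finset.Icc 1 Y).filter Nat.Prime,
          truncFactor f g P Q p (truncExp Y p) n -
        N * ∏ p ∈ (Finset.Icc 1 Y).filter Nat.Prime,
          periodMean (truncFactor f g P Q p (truncExp Y p)) (p ^ truncExp Y p)‖ ≤
      2 * Real.exp (10 * Y) := by
  set S := (Finset.Icc 1 Y).filter Nat.Prime with hS
  have hpr : ∀ p ∈ S, p.Prime := fun p hp => (Finset.mem_filter.1 hp).2
  have h := periodMean_prod S (fun p => p ^ truncExp Y p)
    (fun p n => truncFactor f g P Q p (truncExp Y p) n) (fun p hp => pow_pos (hpr p hp).pos _)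
    (fun p _ => truncFactor_periodic f g P Q p _)
    (fun p hp q hq hpq => Nat.Coprime.pow _ _ ((Nat.coprime_primes (hpr p hp) (hpr q hq)).2 hpq))
  have h1 := norm_sum_Icc_sub_periodMean_le
    (Finset.prod_pos fun p hp => pow_pos (hpr p hp).pos (truncExp Y p)) h.1
    (fun n => norm_prod_le_one S fun p _ => norm_truncFactor_le hf hg P Q p (truncExp Y p) n) N
  rw [h.2] at h1
  refine h1.trans ?_
  have := prod_pow_truncExp_le hY
  linarith

/-- The cost, on average and for the product of the means, of replacing by `1` the factors at a
set of primes. -/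
theorem prod_truncFactor_one_near_one (hf1 : f 1 = 1) (hg1 : g 1 = 1) (hf : ∀ n, ‖f n‖ ≤ 1)
    (hg : ∀ n, ‖g n‖ ≤ 1) (hK : 0 ≤ K) (hPK : RootBound P K) (hQK : RootBound Q K)
    {T : Finset ℕ} {N : ℕ} (hT : ∀ p ∈ T, p.Prime ∧ p ≤ N) :
    ∑ n ∈ Finset.Icc 1 N, ‖∏ p ∈ T, truncFactor f g P Q p 1 n - 1‖ ≤
        N * (2 * K * ∑ p ∈ T, (‖f p - 1‖ + ‖g p - 1‖) / p) ∧
      ‖∏ p ∈ T, periodMean (truncFactor f g P Q p 1) (p ^ 1) - 1‖ ≤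
        2 * K * ∑ p ∈ T, (‖f p - 1‖ + ‖g p - 1‖) / p := by
  have key : ∀ a : ℕ → ℂ, (∀ p, ‖a p‖ ≤ 1) → ‖∏ p ∈ T, a p - 1‖ ≤ ∑ p ∈ T, ‖a p - 1‖ := by
    intro a ha
    have := norm_prod_sub_prod_le T (a := a) (b := fun _ => 1) (fun p _ => ha p) (by simp)
    simpa using this
  constructor
  · calc _ ≤ ∑ n ∈ Finset.Icc 1 N, ∑ p ∈ T, ‖truncFactor f g P Q p 1 n - 1‖ :=
          Finset.sum_le_sum fun n _ => key _ fun p => norm_truncFactor_le hf hg P Q p 1 n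
      _ = ∑ p ∈ T, ∑ n ∈ Finset.Icc 1 N, ‖truncFactor f g P Q p 1 n - 1‖ := Finset.sum_comm
      _ ≤ ∑ p ∈ T, N * (2 * K * ((‖f p - 1‖ + ‖g p - 1‖) / p)) := Finset.sum_le_sum fun p hp =>
          sum_norm_truncFactor_one_sub_one_le hf1 hg1 hf hK hPK hQK (hT p hp).1 (hT p hp).2
      _ = _ := by rw [Finset.mul_sum, Finset.mul_sum]
  · refine (key _ fun p => norm_periodMean_le zero_le_one
      (norm_truncFactor_le hf hg P Q p 1) _).trans ?_
    rw [Finset.mul_sum]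
    exact Finset.sum_le_sum fun p hp =>
      norm_periodMean_truncFactor_one_sub_one_le hf1 hg1 hf hK hPK hQK (hT p hp).1

/-- Primes between `Y` and `t`, where `t ≤ 40 Y`, contribute `O(1 / log t)`. -/
theorem sum_between_le (hf : ∀ n, ‖f n‖ ≤ 1) (hg : ∀ n, ‖g n‖ ≤ 1) {Y : ℕ} {t : ℝ}
    (ht : 1 < t) (hYt : t ≤ 40 * Y) {T : Finset ℕ}
    (hT : ∀ p ∈ T, p.Prime ∧ Y < p ∧ (p : ℝ) ≤ t) :
    ∑ p ∈ T, (‖f p - 1‖ + ‖g p - 1‖) / p ≤ 800 / Real.log t := by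
  have hY0 : (0 : ℝ) < Y := by linarith
  have hlog := Real.log_pos ht
  have h2 : ∀ z : ℂ, ‖z‖ ≤ 1 → ‖z - 1‖ ≤ 2 := fun z hz => by
    refine (norm_sub_le _ _).trans ?_
    rw [norm_one]; linarith
  have hcard : (T.card : ℝ) ≤ 5 * t / Real.log t := by
    refine le_trans ?_ (card_primes_le_mul_div_log ht)
    refine Nat.cast_le.2 (Finset.card_le_card fun p hp => ?_)
    have := hT p hp
    exact Finset.mem_filter.2 ⟨Finset.mem_Icc.2 ⟨this.1.one_le, Nat.le_floor this.2.2⟩, this.1⟩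
  calc _ ≤ ∑ p ∈ T, (4 : ℝ) / Y := by
        refine Finset.sum_le_sum fun p hp => ?_
        have : (Y : ℝ) ≤ p := by exact_mod_cast (hT p hp).2.1.le
        gcongr
        linarith [h2 _ (hf p), h2 _ (hg p)]
    _ = T.card * (4 / Y) := by simp
    _ ≤ 5 * t / Real.log t * (4 / Y) := by gcongr
    _ = 20 / (Y * Real.log t) * t := by ring
    _ ≤ 20 / (Y * Real.log t) * (40 * Y) := by gcongr
    _ = 800 / Real.log t := by field_simp; norm_num

/-- Primes between `x ^ (1 / 8)` and `x` contribute at most a multiple of the distance, as the sum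
of their reciprocals is bounded. -/
theorem sum_norm_sub_one_div_le_polyDist (P : ℤ[X]) {f : ℕ → ℂ} (hf : ∀ n, ‖f n‖ ≤ 1) {x y : ℝ}
    (hx : 4 ≤ x) {T : Finset ℕ}
    (hT : ∀ p ∈ T, p.Prime ∧ p ≤ ⌊x⌋₊ ∧ y ≤ (p : ℝ) ∧ x ^ (1 / 8 : ℝ) ≤ (p : ℝ)) :
    ∑ p ∈ T, ‖f p - 1‖ / p ≤ 8 * polyDist P (fun _ => 1) f y x := by
  have hx0 : 0 < x := by linarith
  have hN : 1 ≤ ⌊x⌋₊ := Nat.le_floor (by push_cast; linarith)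
  have hlog4 : 0 < Real.log 4 := Real.log_pos (by norm_num)
  have hlog : Real.log 4 ≤ Real.log x := Real.log_le_log (by norm_num) hx
  have hD := polyDist_nonneg P (fun _ => 1) f y x
  have h1 : ∑ p ∈ T, (1 : ℝ) / p ≤ 16 := by
    have hz : 1 < x ^ (1 / 8 : ℝ) := Real.one_lt_rpow (by linarith) (by norm_num)
    refine (sum_inv_prime_le hN hz T fun p hp => ⟨(hT p hp).1, (hT p hp).2.1,
      (hT p hp).2.2.2⟩).trans ?_
    rw [Real.log_rpow hx0, div_le_iff₀ (by linarith)]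
    have : Real.log ⌊x⌋₊ ≤ Real.log x :=
      Real.log_le_log (by exact_mod_cast hN) (Nat.floor_le hx0.le)
    linarith
  have h2 := sum_norm_sub_one_sq_div_le_polyDist_sq P hf (y := y) hx0.le T
    fun p hp => ⟨(hT p hp).1, (hT p hp).2.1, (hT p hp).2.2.1⟩
  refine abs_le_of_sq_le_sq' ?_ (by positivity) |>.2
  calc (∑ p ∈ T, ‖f p - 1‖ / p) ^ 2
      ≤ (∑ p ∈ T, (1 : ℝ) / p) * ∑ p ∈ T, ‖f p - 1‖ ^ 2 / p :=
        Finset.sum_sq_le_sum_mul_sum_of_sq_le_mul T (fun _ _ => by positivity)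
          (fun _ _ => by positivity) fun p _ => le_of_eq (by ring)
    _ ≤ 16 * (2 * polyDist P (fun _ => 1) f y x ^ 2) := by
        gcongr
    _ ≤ _ := by nlinarith [sq_nonneg (polyDist P (fun _ => 1) f y x)]

end Ranges

/-! ### Combination of the ranges -/

theorem log_mul_sqrt_le {x : ℝ} (hx : 0 < x) : Real.log x * √x ≤ 2 * x := by
  have hsq : 0 < √x := Real.sqrt_pos.2 hx
  have := Real.log_le_sub_one_of_pos hsq
  rw [Real.log_sqrt hx.le] at this
  nlinarith [Real.mul_self_sqrt hx.le]

theorem log_sq_le_sqrt {x : ℝ} (hx : 1 ≤ x) : Real.log x ^ 2 ≤ 16 * √x := by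
  have h0 : 0 < x := by linarith
  have hs : 0 < √x := Real.sqrt_pos.2 h0
  have hss : 0 < √(√x) := Real.sqrt_pos.2 hs
  have h := Real.log_le_sub_one_of_pos hss
  rw [Real.log_sqrt hs.le, Real.log_sqrt h0.le] at h
  have hl := Real.log_nonneg hx
  nlinarith [Real.mul_self_sqrt hs.le]

/-- The square root of the variance bound, in terms of `1 / r` for `r ≤ log x`. -/
theorem sqrt_variance_le {x r K D N w : ℝ} (hx : 1 ≤ x) (hr : 0 < r) (hrl : r ≤ Real.log x)
    (hK : 0 ≤ K) (hD : 0 ≤ D) (hN : 0 ≤ N) (hNx : N ≤ x) (hwx : w ≤ √x) :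
    √(N * (N * (24 * K ^ 2 * (2 * D ^ 2)) + 8 * w)) ≤ 7 * K * x * D + 12 * x * (1 / r) := by
  have hx0 : 0 < x := by linarith
  have hr1 : 0 ≤ 1 / r := by positivity
  have h1 : x * √x ≤ 16 * (x * (1 / r)) ^ 2 := by
    rw [mul_one_div, div_pow, ← mul_div_assoc, le_div_iff₀ (by positivity)]
    calc x * √x * r ^ 2 ≤ x * √x * Real.log x ^ 2 := by gcongr
      _ ≤ x * √x * (16 * √x) := by gcongr; exact log_sq_le_sqrt hx
      _ = 16 * x * (√x * √x) := by ring
      _ = 16 * x ^ 2 := by rw [Real.mul_self_sqrt hx0.le]; ring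
  have h2 : 0 ≤ K * x * D * (x * (1 / r)) := by positivity
  rw [Real.sqrt_le_left (by positivity)]
  calc N * (N * (24 * K ^ 2 * (2 * D ^ 2)) + 8 * w)
      ≤ N * (N * (24 * K ^ 2 * (2 * D ^ 2)) + 8 * √x) := by gcongr
    _ ≤ x * (x * (24 * K ^ 2 * (2 * D ^ 2)) + 8 * √x) := by gcongr
    _ = 48 * (K * x * D) ^ 2 + 8 * (x * √x) := by ring
    _ ≤ 48 * (K * x * D) ^ 2 + 8 * (16 * (x * (1 / r)) ^ 2) := by gcongr
    _ ≤ 49 * (K * x * D) ^ 2 + 168 * (K * x * D * (x * (1 / r))) + 144 * (x * (1 / r)) ^ 2 := by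
        linarith [sq_nonneg (K * x * D), sq_nonneg (x * (1 / r))]
    _ = (7 * K * x * D + 12 * x * (1 / r)) ^ 2 := by ring

/-- In the mean of a product `s a b c`, the functions `a` and `c` are replaced by `1` and `b` by
its expected value, one after the other; the same is done for the product of the means. -/
theorem norm_sum_mul_sub_le {s a b c : ℕ → ℂ} {ms ma mb mc : ℂ} (hs1 : ∀ n, ‖s n‖ ≤ 1)
    (ha1 : ∀ n, ‖a n‖ ≤ 1) (hb1 : ∀ n, ‖b n‖ ≤ 1) (hms1 : ‖ms‖ ≤ 1) (hma1 : ‖ma‖ ≤ 1)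
    (hmb1 : ‖mb‖ ≤ 1) (N : ℕ) :
    ‖∑ n ∈ Finset.Icc 1 N, s n * (a n * (b n * c n)) - N * (ms * (ma * (mb * mc)))‖ ≤
      (∑ n ∈ Finset.Icc 1 N, ‖a n - 1‖ + (∑ n ∈ Finset.Icc 1 N, ‖b n - mb‖ +
        ∑ n ∈ Finset.Icc 1 N, ‖c n - 1‖)) + ‖∑ n ∈ Finset.Icc 1 N, s n - N * ms‖ +
          N * (‖ma - 1‖ + ‖mc - 1‖) := by
  have hone : ‖(1 : ℂ)‖ ≤ 1 := by simp
  have hpt : ∀ n, ‖s n * (a n * (b n * c n)) - s n * mb‖ ≤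
      ‖a n - 1‖ + (‖b n - mb‖ + ‖c n - 1‖) := by
    intro n
    rw [← mul_sub, norm_mul]
    refine (mul_le_of_le_one_left (norm_nonneg _) (hs1 n)).trans ?_
    have h1 := norm_mul_sub_mul_le (a := a n) (b := b n * c n) (c := 1) (d := mb) (ha1 n) hmb1
    have h2 := norm_mul_sub_mul_le (a := b n) (b := c n) (c := mb) (d := 1) (hb1 n) hone
    rw [one_mul] at h1
    rw [mul_one] at h2
    linarith
  have hmean : ‖ms * mb - ms * (ma * (mb * mc))‖ ≤ ‖ma - 1‖ + ‖mc - 1‖ := by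
    rw [norm_sub_rev, ← mul_sub, norm_mul]
    refine (mul_le_of_le_one_left (norm_nonneg _) hms1).trans ?_
    have h1 := norm_mul_sub_mul_le (a := ma) (b := mb * mc) (c := 1) (d := mb) hma1 hmb1
    have h2 := norm_mul_sub_mul_le (a := mb) (b := mc) (c := mb) (d := 1) hmb1 hone
    rw [one_mul] at h1
    rw [mul_one, sub_self, norm_zero, zero_add] at h2
    linarith
  have heq : ∑ n ∈ Finset.Icc 1 N, s n * (a n * (b n * c n)) - N * (ms * (ma * (mb * mc))) =
      ∑ n ∈ Finset.Icc 1 N, (s n * (a n * (b n * c n)) - s n * mb) +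
        (∑ n ∈ Finset.Icc 1 N, s n - N * ms) * mb +
          N * (ms * mb - ms * (ma * (mb * mc))) := by
    rw [Finset.sum_sub_distrib, ← Finset.sum_mul]
    ring
  rw [heq]
  refine norm_add₃_le.trans (add_le_add (add_le_add ?_ ?_) ?_)
  · rw [← Finset.sum_add_distrib, ← Finset.sum_add_distrib]
    exact norm_sum_le_of_le _ fun n _ => hpt n
  · rw [norm_mul]
    exact mul_le_of_le_one_right (norm_nonneg _) hmb1
  · rw [norm_mul, Complex.norm_natCast]
    gcongr

/-- The numerical constants of the four ranges of primes, added up: `a` and `c` stand for the ranges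
that are replaced by `1`, `b` for the range of concentration, and `s` for the small primes. -/
theorem sum_of_errors_le {N x K D t Sa Sb Sc Es na nc σa σc : ℝ} (hN : 0 ≤ N) (hNx : N ≤ x)
    (hK : 1 ≤ K) (hD : 0 ≤ D) (ht : 0 ≤ t) (hSa : Sa ≤ N * (2 * K * σa)) (hna : na ≤ 2 * K * σa)
    (hσa : σa ≤ 800 * t) (hSc : Sc ≤ N * (2 * K * σc)) (hnc : nc ≤ 2 * K * σc)
    (hσc : σc ≤ 8 * D) (hSb : Sb ≤ x * (55 * K ^ 2 * D) + 12 * x * t) (hEs : Es ≤ 4 * x * t) :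
    Sa + (Sb + Sc) + Es + N * (na + nc) ≤ x * (4000 * K ^ 2 * (D + t)) := by
  have hx : 0 ≤ x := hN.trans hNx
  have hK0 : 0 ≤ K := by linarith
  have hKK : K ≤ K ^ 2 := le_self_pow₀ hK two_ne_zero
  have h1 : 2 * K * σa ≤ 2 * K ^ 2 * (800 * t) := by
    calc 2 * K * σa ≤ 2 * K * (800 * t) := by gcongr
      _ ≤ _ := by gcongr
  have h2 : 2 * K * σc ≤ 2 * K ^ 2 * (8 * D) := by
    calc 2 * K * σc ≤ 2 * K * (8 * D) := by gcongr
      _ ≤ _ := by gcongr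
  have b1 : N * (2 * K * σa) ≤ x * (2 * K ^ 2 * (800 * t)) := by
    calc _ ≤ N * (2 * K ^ 2 * (800 * t)) := by gcongr
      _ ≤ _ := by gcongr
  have b2 : N * (2 * K * σc) ≤ x * (2 * K ^ 2 * (8 * D)) := by
    calc _ ≤ N * (2 * K ^ 2 * (8 * D)) := by gcongr
      _ ≤ _ := by gcongr
  have b3 : N * (na + nc) ≤ N * (2 * K * σa) + N * (2 * K * σc) := by
    rw [← mul_add]
    gcongr
  have b4 : x * t ≤ K ^ 2 * (x * t) :=
    le_mul_of_one_le_left (by positivity) (hK.trans hKK)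
  have b5 : 0 ≤ K ^ 2 * (x * t) := by positivity
  have b6 : 0 ≤ K ^ 2 * (x * D) := by positivity
  linarith

section Combination

variable {f g : ArithmeticFunction ℂ} {P Q : ℤ[X]} {K : ℝ}

/-- The main estimate, for the truncated factors. With `Y` of size `log x / 20`, the primes up to
`Y` are handled by periodicity, those between `log x` and `x ^ (1 / 8)` by concentration, and the
others are negligible. -/
theorem norm_sum_prod_truncFactor_sub_le (hf1 : f 1 = 1) (hg1 : g 1 = 1) (hf : ∀ n, ‖f n‖ ≤ 1)
    (hg : ∀ n, ‖g n‖ ≤ 1) (hK : 1 ≤ K) (hPK : RootBound P K) (hQK : RootBound Q K) {x D : ℝ}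
    {Y : ℕ} (hx : Real.exp 40 ≤ x) (hY : 2 ≤ Y) (hY1 : Real.log x ≤ 40 * Y)
    (hY2 : 20 * Y ≤ Real.log x)
    (hD : D = polyDist P (fun _ => 1) f (Real.log x) x + polyDist Q (fun _ => 1) g (Real.log x) x)
    (hD1 : D ≤ 1) :
    ‖∑ n ∈ Finset.Icc 1 ⌊x⌋₊, ∏ p ∈ (Finset.Icc 1 ⌊x⌋₊).filter Nat.Prime,
          truncFactor f g P Q p (truncExp Y p) n -
        ⌊x⌋₊ * ∏ p ∈ (Finset.Icc 1 ⌊x⌋₊).filter Nat.Prime,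
          periodMean (truncFactor f g P Q p (truncExp Y p)) (p ^ truncExp Y p)‖ ≤
      x * (4000 * K ^ 2 * (D + 1 / Real.log (Real.log x))) := by
  have hK0 : 0 ≤ K := by linarith
  have hx1 : 41 ≤ x := by linarith [Real.add_one_le_exp (40 : ℝ)]
  have hx0 : 0 < x := by linarith
  set l := Real.log x with hl
  have hl40 : 40 ≤ l := by
    rw [hl, Real.le_log_iff_exp_le hx0]; exact hx
  set r := Real.log l with hr
  have hr0 : 0 < r := Real.log_pos (by linarith)
  have hrl : r ≤ l := Real.log_le_self (by linarith)
  set DP := polyDist P (fun _ => 1) f l x with hDP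
  set DQ := polyDist Q (fun _ => 1) g l x with hDQ
  have hDP0 : 0 ≤ DP := polyDist_nonneg _ _ _ _ _
  have hDQ0 : 0 ≤ DQ := polyDist_nonneg _ _ _ _ _
  have hD0 : 0 ≤ D := by rw [hD]; linarith
  set N := ⌊x⌋₊ with hN
  have hNx : (N : ℝ) ≤ x := Nat.floor_le hx0.le
  set Z := ⌊x ^ (1 / 8 : ℝ)⌋₊ with hZ
  have hx8 : 0 ≤ x ^ (1 / 8 : ℝ) := Real.rpow_nonneg hx0.le _
  have hZN : Z ≤ N := by
    refine Nat.floor_le_floor ?_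
    calc x ^ (1 / 8 : ℝ) ≤ x ^ (1 : ℝ) :=
          Real.rpow_le_rpow_of_exponent_le (by linarith) (by norm_num)
      _ = x := Real.rpow_one x
  have hZ4 : (Z : ℝ) ^ 4 ≤ √x := by
    calc (Z : ℝ) ^ 4 ≤ (x ^ (1 / 8 : ℝ)) ^ 4 := by gcongr; exact Nat.floor_le hx8
      _ = √x := by
          rw [← Real.rpow_natCast, ← Real.rpow_mul hx0.le, Real.sqrt_eq_rpow]
          norm_num
  set A := (Finset.Icc 1 N).filter Nat.Prime with hA
  set S := A.filter fun p => p ≤ Y with hS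
  set A' := A.filter fun p => ¬ p ≤ Y with hA'
  set T₁ := A'.filter fun p : ℕ => (p : ℝ) < l with hT₁
  set A'' := A'.filter fun p : ℕ => ¬ (p : ℝ) < l with hA''
  set T₂ := A''.filter fun p => p ≤ Z with hT₂
  set T₃ := A''.filter fun p => ¬ p ≤ Z with hT₃
  have hAmem : ∀ p ∈ A, p.Prime ∧ p ≤ N := fun p hp => by
    obtain ⟨h1, h2⟩ := Finset.mem_filter.1 hp
    exact ⟨h2, (Finset.mem_Icc.1 h1).2⟩
  have hA'mem : ∀ p ∈ A', p.Prime ∧ p ≤ N ∧ Y < p := fun p hp => by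
    obtain ⟨h1, h2⟩ := Finset.mem_filter.1 hp
    exact ⟨(hAmem p h1).1, (hAmem p h1).2, not_le.1 h2⟩
  have hA''mem : ∀ p ∈ A'', p.Prime ∧ p ≤ N ∧ Y < p ∧ l ≤ (p : ℝ) := fun p hp => by
    obtain ⟨h1, h2⟩ := Finset.mem_filter.1 hp
    obtain ⟨h3, h4, h5⟩ := hA'mem p h1
    exact ⟨h3, h4, h5, not_lt.1 h2⟩
  have hT₁mem : ∀ p ∈ T₁, p.Prime ∧ p ≤ N ∧ Y < p ∧ (p : ℝ) ≤ l := fun p hp => by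
    obtain ⟨h1, h2⟩ := Finset.mem_filter.1 hp
    obtain ⟨h3, h4, h5⟩ := hA'mem p h1
    exact ⟨h3, h4, h5, h2.le⟩
  have hT₂mem : ∀ p ∈ T₂, p.Prime ∧ p ≤ N ∧ Y < p ∧ l ≤ (p : ℝ) ∧ p ≤ Z := fun p hp => by
    obtain ⟨h1, h2⟩ := Finset.mem_filter.1 hp
    obtain ⟨h3, h4, h5, h6⟩ := hA''mem p h1
    exact ⟨h3, h4, h5, h6, h2⟩
  have hT₃mem : ∀ p ∈ T₃, p.Prime ∧ p ≤ N ∧ Y < p ∧ l ≤ (p : ℝ) ∧ x ^ (1 / 8 : ℝ) ≤ p :=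
    fun p hp => by
      obtain ⟨h1, h2⟩ := Finset.mem_filter.1 hp
      obtain ⟨h3, h4, h5, h6⟩ := hA''mem p h1
      exact ⟨h3, h4, h5, h6, ((Nat.floor_lt hx8).1 (not_le.1 h2)).le⟩
  have hYN : Y ≤ N := by
    refine Nat.le_floor ?_
    have := Real.log_le_self hx0.le
    linarith
  have hSeq : S = (Finset.Icc 1 Y).filter Nat.Prime := by
    ext p
    simp only [hS, hA, Finset.mem_filter, Finset.mem_Icc]
    constructor
    · rintro ⟨⟨⟨h1, -⟩, h2⟩, h3⟩
      exact ⟨⟨h1, h3⟩, h2⟩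
    · rintro ⟨⟨h1, h3⟩, h2⟩
      exact ⟨⟨⟨h1, h3.trans hYN⟩, h2⟩, h3⟩
  have hsplit : ∀ a : ℕ → ℕ → ℂ, ∏ p ∈ A, a p (truncExp Y p) =
      (∏ p ∈ S, a p (truncExp Y p)) *
        ((∏ p ∈ T₁, a p 1) * ((∏ p ∈ T₂, a p 1) * ∏ p ∈ T₃, a p 1)) := by
    intro a
    have hone : ∀ T : Finset ℕ, (∀ p ∈ T, Y < p) →
        ∏ p ∈ T, a p 1 = ∏ p ∈ T, a p (truncExp Y p) := fun T hT =>
      Finset.prod_congr rfl fun p hp => by rw [truncExp, if_neg (not_le.2 (hT p hp))]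
    rw [hone T₁ fun p hp => (hT₁mem p hp).2.2.1, hone T₂ fun p hp => (hT₂mem p hp).2.2.1,
      hone T₃ fun p hp => (hT₃mem p hp).2.2.1, hT₂, hT₃,
      Finset.prod_filter_mul_prod_filter_not, hT₁, hA'', Finset.prod_filter_mul_prod_filter_not,
      hS, hA', Finset.prod_filter_mul_prod_filter_not]
  -- The four products as functions of `n`, and their expected values.
  set s := fun n => ∏ p ∈ S, truncFactor f g P Q p (truncExp Y p) n with hs
  set a := fun n => ∏ p ∈ T₁, truncFactor f g P Q p 1 n with ha
  set b := fun n => ∏ p ∈ T₂, truncFactor f g P Q p 1 n with hb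
  set c := fun n => ∏ p ∈ T₃, truncFactor f g P Q p 1 n with hc
  set ms := ∏ p ∈ S, periodMean (truncFactor f g P Q p (truncExp Y p)) (p ^ truncExp Y p) with hms
  set ma := ∏ p ∈ T₁, periodMean (truncFactor f g P Q p 1) (p ^ 1) with hma
  set mb := ∏ p ∈ T₂, periodMean (truncFactor f g P Q p 1) (p ^ 1) with hmb
  set mc := ∏ p ∈ T₃, periodMean (truncFactor f g P Q p 1) (p ^ 1) with hmc
  have hmt : ∀ p k, ‖periodMean (truncFactor f g P Q p k) (p ^ k)‖ ≤ 1 := fun p k =>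
    norm_periodMean_le zero_le_one (norm_truncFactor_le hf hg P Q p k) _
  have hs1 : ∀ n, ‖s n‖ ≤ 1 := fun n =>
    norm_prod_le_one _ fun p _ => norm_truncFactor_le hf hg P Q p _ n
  have ha1 : ∀ n, ‖a n‖ ≤ 1 := fun n =>
    norm_prod_le_one _ fun p _ => norm_truncFactor_le hf hg P Q p _ n
  have hb1 : ∀ n, ‖b n‖ ≤ 1 := fun n =>
    norm_prod_le_one _ fun p _ => norm_truncFactor_le hf hg P Q p _ n
  have hms1 : ‖ms‖ ≤ 1 := norm_prod_le_one _ fun p _ => hmt p _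
  have hma1 : ‖ma‖ ≤ 1 := norm_prod_le_one _ fun p _ => hmt p _
  have hmb1 : ‖mb‖ ≤ 1 := norm_prod_le_one _ fun p _ => hmt p _
  -- Bounds for the four ranges.
  have hES : ‖∑ n ∈ Finset.Icc 1 N, s n - N * ms‖ ≤ 4 * x * (1 / r) := by
    have h := norm_sum_prod_small_sub_le (P := P) (Q := Q) hf hg hY N
    rw [← hSeq] at h
    refine h.trans ?_
    have h1 : Real.exp (10 * Y) ≤ √x := by
      rw [← Real.exp_log (Real.sqrt_pos.2 hx0), Real.log_sqrt hx0.le]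
      exact Real.exp_le_exp.2 (by linarith)
    have h2 : √x ≤ 2 * x * (1 / r) := by
      rw [mul_one_div, le_div_iff₀ hr0]
      calc √x * r ≤ √x * l := by gcongr
        _ = l * √x := mul_comm _ _
        _ ≤ 2 * x := log_mul_sqrt_le hx0
    linarith
  have hσ₁ : ∑ p ∈ T₁, (‖f p - 1‖ + ‖g p - 1‖) / p ≤ 800 * (1 / r) := by
    rw [mul_one_div]
    exact sum_between_le hf hg (by linarith) hY1
      fun p hp => ⟨(hT₁mem p hp).1, (hT₁mem p hp).2.2.1, (hT₁mem p hp).2.2.2⟩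
  have hσ₃ : ∑ p ∈ T₃, (‖f p - 1‖ + ‖g p - 1‖) / p ≤ 8 * D := by
    have h1 := sum_norm_sub_one_div_le_polyDist P hf (y := l) (x := x) (by linarith) (T := T₃)
      fun p hp => ⟨(hT₃mem p hp).1, (hT₃mem p hp).2.1, (hT₃mem p hp).2.2.2.1,
        (hT₃mem p hp).2.2.2.2⟩
    have h2 := sum_norm_sub_one_div_le_polyDist Q hg (y := l) (x := x) (by linarith) (T := T₃)
      fun p hp => ⟨(hT₃mem p hp).1, (hT₃mem p hp).2.1, (hT₃mem p hp).2.2.2.1,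
        (hT₃mem p hp).2.2.2.2⟩
    simp only [add_div, Finset.sum_add_distrib]
    rw [hD]
    linarith
  obtain ⟨hEa, hEma⟩ := prod_truncFactor_one_near_one (P := P) (Q := Q) hf1 hg1 hf hg hK0 hPK hQK
    (T := T₁) (N := N) fun p hp => ⟨(hT₁mem p hp).1, (hT₁mem p hp).2.1⟩
  obtain ⟨hEc, hEmc⟩ := prod_truncFactor_one_near_one (P := P) (Q := Q) hf1 hg1 hf hg hK0 hPK hQK
    (T := T₃) (N := N) fun p hp => ⟨(hT₃mem p hp).1, (hT₃mem p hp).2.1⟩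
  have hEb : ∑ n ∈ Finset.Icc 1 N, ‖b n - mb‖ ≤ x * (55 * K ^ 2 * D) + 12 * x * (1 / r) := by
    have hT₂' : ∀ p ∈ T₂, p.Prime ∧ p ≤ ⌊x⌋₊ ∧ l ≤ (p : ℝ) := fun p hp =>
      ⟨(hT₂mem p hp).1, (hT₂mem p hp).2.1, (hT₂mem p hp).2.2.2.1⟩
    have hV : ∑ p ∈ T₂, (‖f p - 1‖ ^ 2 + ‖g p - 1‖ ^ 2) / p ≤ 2 * D ^ 2 := by
      have h1 := sum_norm_sub_one_sq_div_le_polyDist_sq P hf hx0.le T₂ hT₂'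
      have h2 := sum_norm_sub_one_sq_div_le_polyDist_sq Q hg hx0.le T₂ hT₂'
      simp only [add_div, Finset.sum_add_distrib]
      have h3 : 2 * DP ^ 2 + 2 * DQ ^ 2 ≤ 2 * D ^ 2 := by
        have : D ^ 2 = DP ^ 2 + DQ ^ 2 + 2 * (DP * DQ) := by rw [hD]; ring
        linarith [mul_nonneg hDP0 hDQ0]
      linarith
    refine (sum_norm_prod_truncFactor_sub_prod_periodMean_le hf1 hg1 hf hg hK hPK hQK hZN
      (fun p hp => ⟨(hT₂mem p hp).1, (hT₂mem p hp).2.2.2.2⟩) hV).trans ?_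
    have hDD : D ^ 2 ≤ D := pow_le_of_le_one hD0 hD1 two_ne_zero
    have h1 : N * (24 * K ^ 2 * (2 * D ^ 2)) ≤ x * (48 * K ^ 2 * D) := by
      calc _ ≤ x * (24 * K ^ 2 * (2 * D)) := by gcongr
        _ = _ := by ring
    have h2 : √(N * (N * (24 * K ^ 2 * (2 * D ^ 2)) + 8 * (Z : ℝ) ^ 4)) ≤
        7 * K * x * D + 12 * x * (1 / r) :=
      sqrt_variance_le (by linarith) hr0 hrl hK0 hD0 (Nat.cast_nonneg _) hNx hZ4
    have h6 : 7 * K * x * D ≤ x * (7 * K ^ 2 * D) := by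
      have : K ≤ K ^ 2 := le_self_pow₀ hK two_ne_zero
      calc 7 * K * x * D = x * (7 * K * D) := by ring
        _ ≤ _ := by gcongr
    linarith
  have hsum : ∀ n, ∏ p ∈ A, truncFactor f g P Q p (truncExp Y p) n =
      s n * (a n * (b n * c n)) := fun n => hsplit fun p k => truncFactor f g P Q p k n
  have hμ : ∏ p ∈ A, periodMean (truncFactor f g P Q p (truncExp Y p)) (p ^ truncExp Y p) =
      ms * (ma * (mb * mc)) :=
    hsplit fun p k => periodMean (truncFactor f g P Q p k) (p ^ k)
  have hN0 : (0 : ℝ) ≤ N := Nat.cast_nonneg _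
  have htotal := norm_sum_mul_sub_le (c := c) (mc := mc) hs1 ha1 hb1 hms1 hma1 hmb1 N
  simp only [hsum]
  rw [hμ]
  refine htotal.trans ?_
  exact sum_of_errors_le hN0 hNx hK hD0 (one_div_nonneg.2 hr0.le) hEa hEma hσ₁ hEc hEmc hσ₃ hEb hES

end Combination

/-- The estimate for large `x`, in the nontrivial case of a small distance. -/
theorem norm_corrMean_sub_prod_localCorr_le {f g : ArithmeticFunction ℂ} {P Q : ℤ[X]} {K : ℝ}
    (hfm : f.IsMultiplicative) (hgm : g.IsMultiplicative) (hf : ∀ n, ‖f n‖ ≤ 1)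
    (hg : ∀ n, ‖g n‖ ≤ 1) (hK : 1 ≤ K) (hPK : RootBound P K) (hQK : RootBound Q K) {x D : ℝ}
    (hx : Real.exp 40 ≤ x)
    (hcP : ∀ n ∈ Finset.Icc 1 ⌊x⌋₊,
      ((P.eval (n : ℤ)).natAbs.primeFactors.filter fun p : ℕ => x ≤ (p : ℝ)).card ≤
        P.natDegree + 1)
    (hcQ : ∀ n ∈ Finset.Icc 1 ⌊x⌋₊,
      ((Q.eval (n : ℤ)).natAbs.primeFactors.filter fun p : ℕ => x ≤ (p : ℝ)).card ≤
        Q.natDegree + 1)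
    (hD : D = polyDist P (fun _ => 1) f (Real.log x) x + polyDist Q (fun _ => 1) g (Real.log x) x)
    (hD1 : D ≤ 1) :
    ‖corrMean f g P Q x - ∏ p ∈ Finset.Icc 1 ⌊x⌋₊ with p.Prime, localCorr f g P Q p‖ ≤
      5000 * K ^ 2 * (P.natDegree + Q.natDegree + 1) * (D + 1 / Real.log (Real.log x)) := by
  have hK0 : 0 ≤ K := by linarith
  have hx1 : 41 ≤ x := by linarith [Real.add_one_le_exp (40 : ℝ)]
  have hx0 : 0 < x := by linarith
  have hl40 : 40 ≤ Real.log x := by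
    rw [Real.le_log_iff_exp_le hx0]; exact hx
  set Y := ⌊Real.log x / 20⌋₊ with hY
  have hYle : (Y : ℝ) ≤ Real.log x / 20 := Nat.floor_le (by linarith)
  have hYlt := Nat.lt_floor_add_one (Real.log x / 20)
  rw [← hY] at hYlt
  have hY2 : 2 ≤ Y := Nat.le_floor (by push_cast; linarith)
  have hY0 : (0 : ℝ) < Y := by positivity
  have hcore := norm_sum_prod_truncFactor_sub_le hfm.map_one hgm.map_one hf hg hK hPK hQK hx hY2
    (by linarith) (by linarith) hD hD1
  set l := Real.log x with hl
  set r := Real.log l with hr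
  have hr0 : 0 < r := Real.log_pos (by linarith)
  have hrl : r ≤ l := Real.log_le_self (by linarith)
  set DP := polyDist P (fun _ => 1) f l x with hDP
  set DQ := polyDist Q (fun _ => 1) g l x with hDQ
  have hDP0 : 0 ≤ DP := polyDist_nonneg _ _ _ _ _
  have hDQ0 : 0 ≤ DQ := polyDist_nonneg _ _ _ _ _
  set N := ⌊x⌋₊ with hN
  have hNx : (N : ℝ) ≤ x := Nat.floor_le hx0.le
  set A := (Finset.Icc 1 N).filter Nat.Prime with hA
  have hApr : ∀ p ∈ A, p.Prime := fun p hp => (Finset.mem_filter.1 hp).2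
  set M := ∏ p ∈ A, localCorr f g P Q p with hM
  have hM1 : ‖M‖ ≤ 1 :=
    norm_prod_le_one _ fun p hp => norm_localCorr_le hf hg hK0 hPK hQK (hApr p hp)
  have hYr : 2 / (Y : ℝ) ≤ 80 * (1 / r) := by
    rw [mul_one_div, div_le_div_iff₀ hY0 hr0]
    linarith
  have hAcard : (A.card : ℝ) ≤ 5 * x * (1 / r) := by
    refine (card_primes_le_mul_div_log (by linarith : 1 < x)).trans ?_
    rw [mul_one_div]
    gcongr
  have e1 : ‖∑ n ∈ Finset.Icc 1 N, f (P.eval (n : ℤ)).natAbs * g (Q.eval (n : ℤ)).natAbs -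
      ∑ n ∈ Finset.Icc 1 N, ∏ p ∈ A, localFactor f g P Q p n‖ ≤
      4 * K * (P.natDegree + 1) * x * DP + 4 * K * (Q.natDegree + 1) * x * DQ := by
    rw [← Finset.sum_sub_distrib]
    refine (norm_sum_le _ _).trans (le_trans ?_ (add_le_add
      (sum_large_primeFactors_le hK hPK hf (y := l) (by linarith) hcP)
      (sum_large_primeFactors_le hK hQK hg (y := l) (by linarith) hcQ)))
    rw [← Finset.sum_add_distrib]
    refine Finset.sum_le_sum fun n _ => ?_
    have h1 := norm_sub_prod_localPart_le hfm hf (by linarith : 2 ≤ x) (P.eval (n : ℤ)).natAbs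
    have h2 := norm_sub_prod_localPart_le hgm hg (by linarith : 2 ≤ x) (Q.eval (n : ℤ)).natAbs
    have h3 : ∏ p ∈ A, localFactor f g P Q p n =
        (∏ p ∈ A, localPart f p (P.eval (n : ℤ)).natAbs) *
          ∏ p ∈ A, localPart g p (Q.eval (n : ℤ)).natAbs := by
      rw [← Finset.prod_mul_distrib]
      rfl
    rw [h3]
    exact (norm_mul_sub_mul_le (hf _)
      (norm_prod_le_one _ fun p _ => norm_localPart_le hg p _)).trans (add_le_add h1 h2)
  have e2 : ‖∑ n ∈ Finset.Icc 1 N, ∏ p ∈ A, localFactor f g P Q p n -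
      ∑ n ∈ Finset.Icc 1 N, ∏ p ∈ A, truncFactor f g P Q p (truncExp Y p) n‖ ≤
      340 * K * x * (1 / r) := by
    rw [← Finset.sum_sub_distrib]
    refine (norm_sum_le _ _).trans
      ((sum_norm_prod_localFactor_sub_prod_truncFactor_le hf hg hK0 hPK hQK (by omega) A hApr
        N).trans ?_)
    calc 4 * K * (N * (2 / Y) + A.card) ≤ 4 * K * (x * (80 * (1 / r)) + 5 * x * (1 / r)) := by
          gcongr
      _ = _ := by ring
  have e3 : ‖(N : ℂ) * ∏ p ∈ A,
        periodMean (truncFactor f g P Q p (truncExp Y p)) (p ^ truncExp Y p) - N * M‖ ≤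
      320 * K * x * (1 / r) := by
    rw [← mul_sub, norm_mul, Complex.norm_natCast, norm_sub_rev]
    calc _ ≤ x * (4 * K * (2 / Y)) := by
          gcongr
          exact norm_prod_localCorr_sub_prod_periodMean_le hf hg hK0 hPK hQK (by omega) A hApr
      _ ≤ x * (4 * K * (80 * (1 / r))) := by gcongr
      _ = _ := by ring
  have e4 : ‖∑ n ∈ Finset.Icc 1 N, f (P.eval (n : ℤ)).natAbs * g (Q.eval (n : ℤ)).natAbs -
      N * M‖ ≤ (4 * K * (P.natDegree + 1) * x * DP + 4 * K * (Q.natDegree + 1) * x * DQ) +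
        340 * K * x * (1 / r) + x * (4000 * K ^ 2 * (D + 1 / r)) + 320 * K * x * (1 / r) := by
    refine (norm_sub_le_norm_sub_add_norm_sub _ _ _).trans (add_le_add
      ((norm_sub_le_norm_sub_add_norm_sub _ _ _).trans (add_le_add
        ((norm_sub_le_norm_sub_add_norm_sub _ _ _).trans (add_le_add e1 e2)) hcore)) e3)
  refine (norm_div_sub_le_of_norm_sum_sub_le hx0 hM1 e4).trans ?_
  have hxr : 1 ≤ x * (1 / r) := by
    rw [mul_one_div, one_le_div hr0]
    exact hrl.trans (Real.log_le_self hx0.le)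
  have hKK : K ≤ K ^ 2 := le_self_pow₀ hK two_ne_zero
  have hK2 : 1 ≤ K ^ 2 := hK.trans hKK
  set d : ℝ := P.natDegree + Q.natDegree + 1 with hd
  have hdP : (P.natDegree : ℝ) + 1 ≤ d := by
    rw [hd]; linarith [(Nat.cast_nonneg Q.natDegree : (0 : ℝ) ≤ _)]
  have hdQ : (Q.natDegree : ℝ) + 1 ≤ d := by
    rw [hd]; linarith [(Nat.cast_nonneg P.natDegree : (0 : ℝ) ≤ _)]
  have hd1 : 1 ≤ d := by linarith [(Nat.cast_nonneg P.natDegree : (0 : ℝ) ≤ _)]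
  have hD0 : 0 ≤ D := by rw [hD]; linarith
  have hr1 : 0 ≤ 1 / r := by positivity
  have c1 : 4 * K * (P.natDegree + 1) * x * DP ≤ 4 * (K ^ 2 * d * x) * DP := by
    calc _ ≤ 4 * K ^ 2 * d * x * DP := by gcongr
      _ = _ := by ring
  have c2 : 4 * K * (Q.natDegree + 1) * x * DQ ≤ 4 * (K ^ 2 * d * x) * DQ := by
    calc _ ≤ 4 * K ^ 2 * d * x * DQ := by gcongr
      _ = _ := by ring
  have hK2d : K ^ 2 ≤ K ^ 2 * d := le_mul_of_one_le_right (by positivity) hd1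
  have c3 : K * x * (1 / r) ≤ K ^ 2 * d * x * (1 / r) := by
    have := hKK.trans hK2d
    gcongr
  have c4 : x * (4000 * K ^ 2 * (D + 1 / r)) ≤ 4000 * (K ^ 2 * d * x) * (D + 1 / r) := by
    calc x * (4000 * K ^ 2 * (D + 1 / r)) = 4000 * (K ^ 2 * x) * (D + 1 / r) := by ring
      _ ≤ _ := by gcongr
  have c5 : 1 ≤ K ^ 2 * d * x * (1 / r) := by
    have := hK2.trans hK2d
    rw [mul_assoc]
    nlinarith
  have c6 : 0 ≤ K ^ 2 * d * x * D := by positivity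
  rw [div_le_iff₀ hx0]
  have c7 : DP + DQ = D := hD.symm
  have c8 : 4 * (K ^ 2 * d * x) * DP + 4 * (K ^ 2 * d * x) * DQ = 4 * (K ^ 2 * d * x * D) := by
    rw [← c7]; ring
  have c9 : 5000 * K ^ 2 * d * (D + 1 / r) * x =
      5000 * (K ^ 2 * d * x * D) + 5000 * (K ^ 2 * d * x * (1 / r)) := by ring
  have c10 : 4000 * (K ^ 2 * d * x) * (D + 1 / r) =
      4000 * (K ^ 2 * d * x * D) + 4000 * (K ^ 2 * d * x * (1 / r)) := by ring
  rw [c9]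
  rw [c10] at c4
  linarith

theorem theorem1p2 (P Q : ℤ[X])
    (hP : Squarefree (P.map (Int.castRingHom ℚ)))
    (hQ : Squarefree (Q.map (Int.castRingHom ℚ)))
    (hres : P.resultant Q ≠ 0) :
    ∃ C : ℝ, ∀ f g : ArithmeticFunction ℂ, f.IsMultiplicative → g.IsMultiplicative →
      (∀ n, ‖f n‖ ≤ 1) → (∀ n, ‖g n‖ ≤ 1) →
        (∀ p : ℕ, p.Prime →
          Tendsto (corrMean (localPart f p) (localPart g p) P Q) atTop
            (𝓝 (localCorr f g P Q p))) ∧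
        ∀ x : ℝ, Real.exp 1 < x →
          ‖corrMean f g P Q x - ∏ p ∈ Finset.Icc 1 ⌊x⌋₊ with p.Prime, localCorr f g P Q p‖ ≤
            C * (polyDist P (fun _ => 1) f (Real.log x) x +
              polyDist Q (fun _ => 1) g (Real.log x) x +
              1 / Real.log (Real.log x)) := by
  obtain ⟨K₁, hK₁, hPK₁⟩ := exists_rootBound P hP
  obtain ⟨K₂, -, hQK₂⟩ := exists_rootBound Q hQ
  obtain ⟨x₁, hx₁⟩ := exists_card_large_primeFactors_le P
  obtain ⟨x₂, hx₂⟩ := exists_card_large_primeFactors_le Q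
  set K := max K₁ K₂
  have hK : 1 ≤ K := hK₁.trans (le_max_left _ _)
  have hPK : RootBound P K := hPK₁.mono (le_max_left _ _)
  have hQK : RootBound Q K := hQK₂.mono (le_max_right _ _)
  set x₀ := max (Real.exp 40) (max x₁ x₂) with hx₀
  set r₀ := Real.log (Real.log x₀) with hr₀
  set C₁ := 5000 * K ^ 2 * ((P.natDegree : ℝ) + Q.natDegree + 1) with hC₁
  have hC₁0 : 0 ≤ C₁ := by positivity
  refine ⟨C₁ + 2 * |r₀| + 2, fun f g hfm hgm hf hg =>
    ⟨fun p hp => tendsto_corrMean_localPart hf hg (by linarith) hPK hQK hp, fun x hx => ?_⟩⟩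
  have hx0 : 0 < x := (Real.exp_pos 1).trans hx
  have hl : 1 < Real.log x := (Real.lt_log_iff_exp_lt hx0).2 hx
  have hr : 0 < Real.log (Real.log x) := Real.log_pos hl
  have hDP0 := polyDist_nonneg P (fun _ => 1) f (Real.log x) x
  have hDQ0 := polyDist_nonneg Q (fun _ => 1) g (Real.log x) x
  have hri : 0 < 1 / Real.log (Real.log x) := by positivity
  have htriv : ‖corrMean f g P Q x - ∏ p ∈ Finset.Icc 1 ⌊x⌋₊ with p.Prime,
      localCorr f g P Q p‖ ≤ 2 := by
    have h1 := norm_corrMean_le hf hg P Q hx0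
    have h2 : ‖∏ p ∈ Finset.Icc 1 ⌊x⌋₊ with p.Prime, localCorr f g P Q p‖ ≤ 1 :=
      norm_prod_le_one _ fun p hp =>
        norm_localCorr_le hf hg (by linarith) hPK hQK (Finset.mem_filter.1 hp).2
    linarith [norm_sub_le (corrMean f g P Q x)
      (∏ p ∈ Finset.Icc 1 ⌊x⌋₊ with p.Prime, localCorr f g P Q p)]
  set D := polyDist P (fun _ => 1) f (Real.log x) x + polyDist Q (fun _ => 1) g (Real.log x) x
    with hD
  set η := D + 1 / Real.log (Real.log x) with hη
  have hη0 : 0 < η := by linarith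
  have hr₀a := abs_nonneg r₀
  -- The left side is at most `2`, so only large `x` and `D ≤ 1` are of interest.
  rcases lt_or_ge 1 D with hD1 | hD1
  · nlinarith [mul_nonneg hC₁0 hη0.le, mul_nonneg hr₀a hη0.le]
  rcases lt_or_ge x x₀ with hxx | hxx
  · have h1 : Real.log (Real.log x) ≤ |r₀| := by
      refine le_trans ?_ (le_abs_self r₀)
      exact Real.log_le_log (by linarith) (Real.log_le_log hx0 hxx.le)
    have h2 : 1 ≤ |r₀| * η := by
      calc (1 : ℝ) = Real.log (Real.log x) * (1 / Real.log (Real.log x)) := by field_simp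
        _ ≤ |r₀| * η := by gcongr; linarith
    nlinarith [mul_nonneg hC₁0 hη0.le]
  · have h := norm_corrMean_sub_prod_localCorr_le hfm hgm hf hg hK hPK hQK
      ((le_max_left _ _).trans hxx)
      (hx₁ x ((le_max_left _ _).trans ((le_max_right _ _).trans hxx)))
      (hx₂ x ((le_max_right _ _).trans ((le_max_right _ _).trans hxx))) hD hD1
    refine h.trans ?_
    rw [← hC₁]
    nlinarith [mul_nonneg hr₀a hη0.le]
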